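/- Let $d\geqslant 1$, $k=d+1$ and $\ell\in\mathbb N$. Let $\boldsymbol\omega=(\omega_1,\dots,\omega_k)$, where each $\omega_i:\mathbb R\to[0,\infty)$ is $\ell$ times continuously differentiable, is supported in $[-2,2]$, and has Fourier transform $\widehat\omega_i(\xi)=\int_{\mathbb R}\omega_i(x)e^{-2\pi i\xi x}\,\mathrm dx$ satisfying $\widehat\omega_i\geqslant 0$ everywhere and $\widehat\omega_i(0)>0$. Let $\Lambda$ be a unimodular lattice in $\mathbb R^k$ (a discrete additive subgroup of full rank and covolume $1$), with dual lattice $\Lambda^*=\{y\in\mathbb R^k:\langle y,x\rangle\in\mathbb Z\text{ for all }x\in\Lambda\}$; equivalently, $\Lambda^*=(A^{-1})^T\mathbb Z^k$ if $\Lambda=A\mathbb Z^k$. Write vectors of $\mathbb R^k$ as $(\boldsymbol\lambda,\lambda_k)$ with $\boldsymbol\lambda\in\mathbb R^d$, and put $H(\boldsymbol\lambda)=\prod_{i\leqslant d}\max\{1,|\lambda_i|\}$. For real $N\geqslant 1$, define the smooth lattice discrepancy $$D_{\boldsymbol\omega}(\Lambda;N)=\sup_{\boldsymbol\gamma\in\mathbb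 R^d,\ \boldsymbol\rho\in(0,1/2)^d}\left|\sum_{(\boldsymbol\lambda,\lambda_k)\in\Lambda}\omega_k\left(\frac{\lambda_k}{N}\right)\prod_{i\leqslant d}\omega_i\left(\frac{\lambda_i-\gamma_i}{\rho_i}\right)-\widehat\omega_1(0)\cdots\widehat\omega_k(0)\,\rho_1\cdots\rho_d N\right|\in[0,\infty].$$ Let $\phi:[1,\infty)\to[1,\infty)$ be non-decreasing with $$\xi:=\limsup_{x\to\infty}\frac{\phi(2x)}{\phi(x)}<\infty,$$ and suppose that $$|H(\boldsymbol\lambda)\lambda_k|>\frac1{\phi(H(\boldsymbol\lambda))}\qquad\text{for every non-zero }(\boldsymbol\lambda,\lambda_k)\in\Lambda^*.$$ For $x\geqslant\phi(1)$ let $L(x)=\sup\{H\geqslant 1: H\phi(H)\leqslant x\}$; this is the unique $H\in[1,x]$ with $H\phi(H)=x$ whenever such an $H$ exists, in particular for every $x\geqslant\phi(1)$ if $\phi$ is continuous. If $$\ell>2+2\,\frac{\log\xi}{\log 2},$$ then $D_{\boldsymbol\omega}(\Lambda;N)\ll\phi(L(N))$, that is, there is a constant $C>0$, not depending on $N$,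 such that $$D_{\boldsymbol\omega}(\Lambda;N)\leqslant C\,\phi(L(N))\qquad\text{for all real }N\geqslant\phi(1).$$ -/

import Mathlib

namespace SmoothDiscrepancy

open Filter MeasureTheory
open scoped FourierTransform ENNReal Matrix

noncomputable section

/-- The Fourier transform `∫ f(x) e(-ξ x) dx` of a real-valued function on the line,
with `e(z) = exp(2πiz)`. -/
def hat (f : ℝ → ℝ) (ξ : ℝ) : ℂ := 𝓕 (fun x : ℝ => (f x : ℂ)) ξ

/-- The class of weights `ω = (ω₁, …, ω_k)`: each `ω_i` is a non-negative `C^ℓ` function on the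
line, supported in `[-2, 2]`, whose Fourier transform is real and non-negative everywhere, and
positive at the origin. -/
structure IsWeight (k ℓ : ℕ) (ω : Fin k → ℝ → ℝ) : Prop where
  nonneg : ∀ i x, 0 ≤ ω i x
  supp : ∀ i, tsupport (ω i) ⊆ Set.Icc (-2) 2
  contDiff : ∀ i, ContDiff ℝ (ℓ : WithTop ℕ∞) (ω i)
  hat_im : ∀ i ξ, (hat (ω i) ξ).im = 0
  hat_nonneg : ∀ i ξ, 0 ≤ (hat (ω i) ξ).re
  hat_zero_pos : ∀ i, 0 < (hat (ω i) 0).re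

/-- The constant `𝔠(ω) = ω̂₁(0) ⋯ ω̂_k(0)`; each factor is the integral of the real function `ω_i`,
so it is real. -/
def weightConst {k : ℕ} (ω : Fin k → ℝ → ℝ) : ℝ := ∏ i, (hat (ω i) 0).re

/-- The multiplicative height `H(m) = ∏ max{1, |m_i|}`. -/
def height {d : ℕ} (m : Fin d → ℝ) : ℝ := ∏ i, max 1 |m i|

/-- The dual lattice: all vectors whose inner product with every vector of `Λ` is an integer. -/
def dualLattice {k : ℕ} (Λ : Submodule ℤ (Fin k → ℝ)) : Submodule ℤ (Fin k → ℝ) where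
  carrier := {y | ∀ x ∈ Λ, ∃ n : ℤ, y ⬝ᵥ x = n}
  zero_mem' := fun x _ => ⟨0, by simp⟩
  add_mem' := by
    intro a b ha hb x hx
    obtain ⟨m, hm⟩ := ha x hx
    obtain ⟨n, hn⟩ := hb x hx
    exact ⟨m + n, by rw [add_dotProduct, hm, hn]; push_cast; rfl⟩
  smul_mem' := by
    intro c a ha x hx
    obtain ⟨m, hm⟩ := ha x hx
    exact ⟨c * m, by rw [smul_dotProduct, hm]; simp⟩

/-- If `Λ = A ℤ^k` with `A` invertible then the dual lattice is `(A⁻¹)ᵀ ℤ^k`. -/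
theorem mem_dualLattice_iff {k : ℕ} (A : Matrix (Fin k) (Fin k) ℝ) (hA : IsUnit A.det)
    (Λ : Submodule ℤ (Fin k → ℝ))
    (hΛ : ∀ x, x ∈ Λ ↔ ∃ n : Fin k → ℤ, x = A *ᵥ (fun i => (n i : ℝ)))
    (y : Fin k → ℝ) :
    y ∈ dualLattice Λ ↔ ∃ m : Fin k → ℤ, y = (A⁻¹)ᵀ *ᵥ (fun i => (m i : ℝ)) := by
  constructor
  · intro hy
    have h : ∀ i, ∃ n : ℤ, (Aᵀ *ᵥ y) i = n := by
      intro i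
      obtain ⟨n, hn⟩ := hy (A *ᵥ (fun j => ((Pi.single i 1 : Fin k → ℤ) j : ℝ)))
        ((hΛ _).2 ⟨_, rfl⟩)
      refine ⟨n, ?_⟩
      rw [← hn]
      have e : (fun j => ((Pi.single i 1 : Fin k → ℤ) j : ℝ)) = Pi.single i (1 : ℝ) := by
        funext j
        by_cases hj : j = i
        · subst hj; simp
        · simp [hj]
      rw [e, Matrix.dotProduct_mulVec, ← Matrix.mulVec_transpose]
      simp
    choose m hm using h
    refine ⟨m, ?_⟩
    have e : (fun i => (m i : ℝ)) = Aᵀ *ᵥ y := by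
      funext i; rw [hm i]
    rw [e, Matrix.mulVec_mulVec, ← Matrix.transpose_mul, Matrix.mul_nonsing_inv A hA]
    simp
  · rintro ⟨m, rfl⟩ x hx
    obtain ⟨n, rfl⟩ := (hΛ x).1 hx
    refine ⟨∑ i, m i * n i, ?_⟩
    rw [Matrix.mulVec_transpose, ← Matrix.dotProduct_mulVec, Matrix.mulVec_mulVec,
      Matrix.nonsing_inv_mul A hA, Matrix.one_mulVec]
    simp [dotProduct]

/-- The function `L` attached to `φ : [1, ∞) → [1, ∞)`: `L(x)` is the `H ≥ 1` such that
`H φ(H) = x` (see `invL_eq`). If `φ` jumps, so that the increasing function `H φ(H)` may skip the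
value `x`, then `L(x)` is the point at which it passes `x`. -/
def invL (φ : ℝ → ℝ) (x : ℝ) : ℝ := sSup {H : ℝ | 1 ≤ H ∧ H * φ H ≤ x}

/-- Whenever the equation `H φ(H) = x` has a solution `H ≥ 1`, this solution is `L(x)`. -/
theorem invL_eq (φ : ℝ → ℝ) (hmono : MonotoneOn φ (Set.Ici 1)) (hone : ∀ x, 1 ≤ x → 1 ≤ φ x)
    (H x : ℝ) (hH : 1 ≤ H) (hx : H * φ H = x) : invL φ x = H := by
  apply IsGreatest.csSup_eq
  refine ⟨⟨hH, hx.le⟩, ?_⟩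
  rintro H' ⟨h1, h2⟩
  by_contra! hlt
  have h3 : φ H ≤ φ H' := hmono hH h1 hlt.le
  have h4 := hone H hH
  nlinarith

/-- The smooth discrepancy of `Λ ⊆ ℝ^{d+1}` in the box with centre `γ` and side lengths `ρ`. The sum
has finitely many non-zero terms when `Λ` is discrete, since the weights have compact support. -/
def boxDiscrepancy {d : ℕ} (ω : Fin (d + 1) → ℝ → ℝ) (Λ : Submodule ℤ (Fin (d + 1) → ℝ))
    (γ ρ : Fin d → ℝ) (N : ℝ) : ℝ :=
  (∑' v : Λ, ω (Fin.last d) ((v : Fin (d + 1) → ℝ) (Fin.last d) / N) *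
      ∏ i : Fin d, ω i.castSucc (((v : Fin (d + 1) → ℝ) i.castSucc - γ i) / ρ i))
    - weightConst ω * ((∏ i, ρ i) * N)

/-- The smooth lattice discrepancy: the supremum, in `[0, ∞]`, of the absolute discrepancy over all
boxes with `γ ∈ ℝ^d` and `ρ ∈ (0, 1/2)^d`. -/
def latticeDiscrepancy {d : ℕ} (ω : Fin (d + 1) → ℝ → ℝ) (Λ : Submodule ℤ (Fin (d + 1) → ℝ))
    (N : ℝ) : ℝ≥0∞ :=
  ⨆ (γ : Fin d → ℝ) (ρ : Fin d → ℝ) (_ : ∀ i, ρ i ∈ Set.Ioo (0 : ℝ) (1 / 2)),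
    ENNReal.ofReal |boxDiscrepancy ω Λ γ ρ N|

end

end SmoothDiscrepancy

namespace SmoothDiscrepancy

open Filter MeasureTheory
open scoped FourierTransform ENNReal Matrix

/-! Write `P = ∏ ρ_i` and `L = L(N)`, so that `N ≍ L φ(L)`. Poisson summation turns the lattice sum
into a sum over `Λ*`. The zero frequency is exactly the main term, and repeated integration by parts
bounds the frequency `v ≠ 0` by a constant times `N P ∏ min(1, (ρ_i max(1,|v_i|))^{-ℓ}) (N
v_k)^{-2}`.

Sort these frequencies by the dyadic sizes `2^{a_i}` of their first `d` coordinates. Differences of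
two vectors in one class are again in `Λ*`, with height at most `H = ∏ 4·2^{a_i}`. The Diophantine
condition therefore makes the last coordinates `1/(H φ(H))`-separated and at least that far from
`0`, and `∑ v_k^{-2} ≪ (H φ(H))²` over the class (`sum_inv_sq_class_le`).

The doubling hypothesis gives `φ` growth of some exponent `β` with `2 + 2β < ℓ`, whence `(H φ(H)/N)²
≪ (H/L)² + (H/L)^{2+2β}` (`sq_growth_le`). If `L P ≥ 1`, each power of `H/L` splits into powers of
the `ρ_i 2^{a_i}`. The sum over classes factors into one-variable dyadic sums, which converge at
both ends because the exponents lie strictly between `0` and `ℓ`. The total is `≪ N/L ≪ φ(L)`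
(`exists_dual_sum_le`).

If `L P < 1`, enlarge the box to volume `1/L` and majorise the weights by bump functions. By the
first case the lattice sum is `≪ N/L + φ(L) ≪ φ(L)`, and the main term is no larger. -/

/-! ### Growth of `φ` and the size of `L(N)`. -/

/-- A function with doubling constant of logarithm less than `(ℓ - 2) / 2` has polynomial growth of
an exponent `β` with `2 + 2β < ℓ`, uniformly in the base point. -/
theorem exists_growth {φ : ℝ → ℝ} (hmono : MonotoneOn φ (Set.Ici 1))
    (hone : ∀ x, 1 ≤ x → 1 ≤ φ x) {ξ : ℝ} {ℓ : ℕ}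
    (hξ : Filter.limsup (fun x : ℝ => ((φ (2 * x) / φ x : ℝ) : EReal)) Filter.atTop = (ξ : EReal))
    (hℓ : 2 + 2 * (Real.log ξ / Real.log 2) < (ℓ : ℝ)) :
    ∃ β K : ℝ, 0 ≤ β ∧ 2 + 2 * β < ℓ ∧ 1 ≤ K ∧
      ∀ x u : ℝ, 1 ≤ x → 1 ≤ u → φ (u * x) ≤ K * u ^ β * φ x := by
  have hl2 : 0 < Real.log 2 := Real.log_pos (by norm_num)
  have hξ1 : 1 ≤ ξ := by
    have h1 : ((1 : ℝ) : EReal) ≤ (ξ : EReal) := by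
      rw [← hξ]
      refine le_limsup_of_frequently_le' (Eventually.frequently ?_)
      filter_upwards [eventually_ge_atTop 1] with x hx
      rw [EReal.coe_le_coe_iff, le_div_iff₀ (by linarith [hone x hx]), one_mul]
      exact hmono hx (Set.mem_Ici.2 (by linarith)) (by linarith)
    exact_mod_cast h1
  set b := Real.log ξ / Real.log 2 with hb
  have hb0 : 0 ≤ b := div_nonneg (Real.log_nonneg hξ1) hl2.le
  -- The midpoint of `log₂ ξ` and `(ℓ - 2)/2`: above the first, so that `2^β` is eventually a
  -- doubling constant, and below the second, so that `2 + 2β < ℓ`.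
  set β := (b + ((ℓ : ℝ) - 2) / 2) / 2 with hβ
  have hbβ : b < β := by rw [hβ]; linarith
  have hβ0 : 0 ≤ β := hb0.trans hbβ.le
  have hξβ : ξ < (2 : ℝ) ^ β := by
    rw [Real.rpow_def_of_pos (by norm_num), ← Real.log_lt_iff_lt_exp (by linarith)]
    rw [hb, div_lt_iff₀ hl2] at hbβ
    linarith
  have hev : ∀ᶠ x : ℝ in atTop, ((φ (2 * x) / φ x : ℝ) : EReal) < (((2 : ℝ) ^ β : ℝ) : EReal) := by
    refine eventually_lt_of_limsup_lt ?_
    rw [hξ]; exact_mod_cast hξβ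
  obtain ⟨x₀, hx₀⟩ := eventually_atTop.1 (hev.and (eventually_ge_atTop 1))
  set y := max x₀ 1
  have hy1 : 1 ≤ y := le_max_right _ _
  have hdbl : ∀ x, y ≤ x → φ (2 * x) ≤ 2 ^ β * φ x := by
    intro x hx
    have h := (hx₀ x ((le_max_left _ _).trans hx)).1
    rw [EReal.coe_lt_coe_iff, div_lt_iff₀ (by linarith [hone x (hy1.trans hx)])] at h
    exact h.le
  have hpow : ∀ (n : ℕ) x, y ≤ x → φ (2 ^ n * x) ≤ ((2 : ℝ) ^ n) ^ β * φ x := by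
    intro n x hx
    induction n with
    | zero => simp
    | succ n ih =>
      have h1 : (1 : ℝ) ≤ 2 ^ n := one_le_pow₀ (by norm_num)
      have h2 : y ≤ 2 ^ n * x := hx.trans (by nlinarith)
      calc φ (2 ^ (n + 1) * x) = φ (2 * (2 ^ n * x)) := by ring_nf
        _ ≤ 2 ^ β * φ (2 ^ n * x) := hdbl _ h2
        _ ≤ 2 ^ β * (((2 : ℝ) ^ n) ^ β * φ x) := by gcongr
        _ = ((2 : ℝ) ^ (n + 1)) ^ β * φ x := by
          rw [pow_succ, Real.mul_rpow (by positivity) (by norm_num)]; ring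
  have hy : 1 ≤ φ y := hone y hy1
  have hu : ∀ x u : ℝ, y ≤ x → 1 ≤ u → φ (u * x) ≤ 2 ^ β * u ^ β * φ x := by
    intro x u hx hu
    obtain ⟨n, hn1, hn2⟩ := exists_nat_pow_near hu (by norm_num : (1 : ℝ) < 2)
    have hx1 := hy1.trans hx
    have h0 := hone x hx1
    calc φ (u * x) ≤ φ (2 ^ (n + 1) * x) :=
          hmono (Set.mem_Ici.2 (by nlinarith)) (Set.mem_Ici.2 (by nlinarith)) (by nlinarith)
      _ ≤ ((2 : ℝ) ^ (n + 1)) ^ β * φ x := hpow _ _ hx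
      _ ≤ (2 * u) ^ β * φ x := by
          have : (2 : ℝ) ^ (n + 1) ≤ 2 * u := by rw [pow_succ]; linarith
          gcongr
      _ = _ := by rw [Real.mul_rpow (by norm_num) (by linarith)]
  have h2β : (1 : ℝ) ≤ 2 ^ β := Real.one_le_rpow (by norm_num) hβ0
  -- The factor `φ y` pays for base points `x < y`, where doubling is not known: there `φ (u x) ≤ φ
  -- (u y)` and `φ x ≥ 1`.
  refine ⟨β, 2 ^ β * φ y, hβ0, by rw [hβ]; linarith, by nlinarith, fun x u hx hu1 => ?_⟩
  have hφx := hone x hx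
  have huβ : (1 : ℝ) ≤ u ^ β := Real.one_le_rpow hu1 hβ0
  rcases le_total y x with h | h
  · refine (hu x u h hu1).trans ?_
    have : 2 ^ β * u ^ β * φ x * 1 ≤ 2 ^ β * u ^ β * φ x * φ y := by gcongr
    linarith
  · calc φ (u * x) ≤ φ (u * y) :=
          hmono (Set.mem_Ici.2 (by nlinarith)) (Set.mem_Ici.2 (by nlinarith)) (by nlinarith)
      _ ≤ 2 ^ β * u ^ β * φ y * 1 := by simpa using hu y u le_rfl hu1
      _ ≤ 2 ^ β * u ^ β * φ y * φ x := by gcongr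
      _ = _ := by ring

/-- The value `L = L(N)` satisfies `N ≍ L φ(L)`. -/
theorem invL_bounds {φ : ℝ → ℝ} (hmono : MonotoneOn φ (Set.Ici 1))
    (hone : ∀ x, 1 ≤ x → 1 ≤ φ x) {β K : ℝ}
    (hgrow : ∀ x u : ℝ, 1 ≤ x → 1 ≤ u → φ (u * x) ≤ K * u ^ β * φ x) {N : ℝ} (hN : φ 1 ≤ N) :
    1 ≤ invL φ N ∧ N ≤ 2 * (K * 2 ^ β) * (invL φ N * φ (invL φ N)) ∧
      invL φ N * φ (invL φ N) ≤ 2 * (K * 2 ^ β) * N := by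
  set S := {H : ℝ | 1 ≤ H ∧ H * φ H ≤ N} with hS
  have hL : invL φ N = sSup S := rfl
  have h1S : (1 : ℝ) ∈ S := ⟨le_rfl, by simpa using hN⟩
  have hbdd : BddAbove S := by
    refine ⟨N, fun H hH => ?_⟩
    have := hone H hH.1
    nlinarith [hH.1, hH.2]
  have hL1 : 1 ≤ invL φ N := le_csSup hbdd h1S
  refine ⟨hL1, ?_, ?_⟩
  -- The supremum need not be attained when `φ` jumps. The point `2L` outside `S` gives one bound,
  -- some `H ∈ S` with `H > L/2` the other, each at the cost of one doubling of `φ`.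
  · have hnot : 2 * invL φ N ∉ S := fun h => by
      have := le_csSup hbdd h
      rw [← hL] at this; linarith
    have h2 : N < 2 * invL φ N * φ (2 * invL φ N) := by
      by_contra! h
      exact hnot ⟨by linarith, h⟩
    have h3 := hgrow (invL φ N) 2 hL1 (by norm_num)
    nlinarith
  · obtain ⟨H, hH, hlt⟩ := exists_lt_of_lt_csSup ⟨1, h1S⟩
      (show invL φ N / 2 < sSup S by rw [← hL]; linarith)
    have h3 := hgrow H 2 hH.1 (by norm_num)
    have h4 : φ (invL φ N) ≤ φ (2 * H) :=
      hmono hL1 (Set.mem_Ici.2 (by linarith [hH.1])) (by linarith)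
    have h5 := hone _ hL1
    have h6 := hone _ hH.1
    have hKpos : 0 < K * 2 ^ β := by
      by_contra! h
      nlinarith
    calc invL φ N * φ (invL φ N) ≤ (2 * H) * (K * 2 ^ β * φ H) := by
          apply mul_le_mul (by linarith) (h4.trans h3) (by linarith) (by linarith [hH.1])
      _ = 2 * (K * 2 ^ β) * (H * φ H) := by ring
      _ ≤ _ := by gcongr; exact hH.2

/-! ### Dyadic sums and sums over separated points. -/

/-- The model decay `min(1, t^{-ℓ})` of the Fourier transform of a `C^ℓ` weight. -/
noncomputable def decay (ℓ : ℕ) (t : ℝ) : ℝ := min 1 (t ^ ℓ)⁻¹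

theorem decay_nonneg {ℓ : ℕ} {t : ℝ} (ht : 0 ≤ t) : 0 ≤ decay ℓ t :=
  le_min zero_le_one (by positivity)

theorem decay_anti {ℓ : ℕ} {s t : ℝ} (hs : 0 < s) (hst : s ≤ t) : decay ℓ t ≤ decay ℓ s :=
  min_le_min le_rfl (by gcongr)

theorem geom_partial_le {q : ℝ} (h0 : 0 ≤ q) (h1 : q < 1) (M : ℕ) :
    ∑ j ∈ Finset.range M, q ^ j ≤ (1 - q)⁻¹ := by
  rw [← tsum_geometric_of_lt_one h0 h1]
  exact (summable_geometric_of_lt_one h0 h1).sum_le_tsum _ (fun _ _ => by positivity)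

/-- Dyadic sums of `min(u^s, u^{s-ℓ})` are bounded independently of the starting point. -/
theorem exists_dyadic_sum_le {ℓ : ℕ} {s : ℝ} (hs : 0 < s) (hsℓ : s < ℓ) :
    ∃ K : ℝ, 0 < K ∧ ∀ ρ : ℝ, 0 < ρ → ρ ≤ 1 → ∀ M : ℕ,
      ∑ a ∈ Finset.range M, decay ℓ (ρ * 2 ^ a) * (ρ * 2 ^ a) ^ s ≤ K := by
  set p : ℝ := 2 ^ (-s) with hp
  set q : ℝ := 2 ^ (s - ℓ) with hq
  have hp0 : 0 < p := by positivity
  have hq0 : 0 < q := by positivity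
  have hp1 : p < 1 := Real.rpow_lt_one_of_one_lt_of_neg (by norm_num) (by linarith)
  have hq1 : q < 1 := Real.rpow_lt_one_of_one_lt_of_neg (by norm_num) (by linarith)
  have hA : 0 < (1 - p)⁻¹ := inv_pos.2 (by linarith)
  have hB : 0 < (1 - q)⁻¹ := inv_pos.2 (by linarith)
  refine ⟨(1 - p)⁻¹ + (1 - q)⁻¹, by positivity, fun ρ hρ hρ1 M => ?_⟩
  -- The peak is at `2^n ≈ 1/ρ`. Below it the terms are at most `(ρ 2^a)^s`, above it at most `(ρ
  -- 2^a)^{s-ℓ}`, so both halves are geometric when read away from the peak.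
  obtain ⟨n, hn1, hn2⟩ := exists_nat_pow_near ((one_le_inv₀ hρ).2 hρ1) (by norm_num : (1 : ℝ) < 2)
  have hn1' : ρ * 2 ^ n ≤ 1 := by
    have := mul_le_mul_of_nonneg_left hn1 hρ.le
    rwa [mul_inv_cancel₀ hρ.ne'] at this
  have hn2' : 1 ≤ ρ * 2 ^ (n + 1) := by
    have := mul_le_mul_of_nonneg_left hn2.le hρ.le
    rwa [mul_inv_cancel₀ hρ.ne'] at this
  have hpos : ∀ a : ℕ, 0 < ρ * 2 ^ a := fun a => by positivity
  calc ∑ a ∈ Finset.range M, decay ℓ (ρ * 2 ^ a) * (ρ * 2 ^ a) ^ s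
      ≤ ∑ a ∈ Finset.range (n + 1 + M), decay ℓ (ρ * 2 ^ a) * (ρ * 2 ^ a) ^ s := by
        refine Finset.sum_le_sum_of_subset_of_nonneg (Finset.range_mono (by omega))
          fun a _ _ => ?_
        exact mul_nonneg (decay_nonneg (hpos a).le) (Real.rpow_nonneg (hpos a).le _)
    _ ≤ _ := by
        rw [Finset.sum_range_add]
        refine add_le_add ?_ ?_
        · rw [← Finset.sum_range_reflect]
          refine le_trans (Finset.sum_le_sum fun j hj => ?_) (geom_partial_le hp0.le hp1 (n + 1))
          have hj' : j ≤ n := by have := Finset.mem_range.1 hj; omega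
          have hb : ρ * 2 ^ (n + 1 - 1 - j) ≤ ((2 : ℝ) ^ j)⁻¹ := by
            rw [← one_div, le_div_iff₀ (by positivity), mul_assoc, ← pow_add,
              show n + 1 - 1 - j + j = n by omega]
            exact hn1'
          calc decay ℓ (ρ * 2 ^ (n + 1 - 1 - j)) * (ρ * 2 ^ (n + 1 - 1 - j)) ^ s
              ≤ 1 * (((2 : ℝ) ^ j)⁻¹) ^ s := by
                gcongr
                exact min_le_left _ _
            _ = p ^ j := by
                rw [one_mul, hp, ← Real.rpow_natCast, ← Real.rpow_natCast,
                  ← Real.rpow_neg (by norm_num), ← Real.rpow_mul (by norm_num),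
                  ← Real.rpow_mul (by norm_num)]
                ring_nf
        · refine le_trans (Finset.sum_le_sum fun j _ => ?_) (geom_partial_le hq0.le hq1 M)
          have hb : (2 : ℝ) ^ j ≤ ρ * 2 ^ (n + 1 + j) := by
            rw [pow_add, ← mul_assoc]
            exact le_mul_of_one_le_left (by positivity) hn2'
          have hu := hpos (n + 1 + j)
          calc decay ℓ (ρ * 2 ^ (n + 1 + j)) * (ρ * 2 ^ (n + 1 + j)) ^ s
              ≤ ((ρ * 2 ^ (n + 1 + j)) ^ ℓ)⁻¹ * (ρ * 2 ^ (n + 1 + j)) ^ s := by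
                gcongr
                exact min_le_right _ _
            _ = (ρ * 2 ^ (n + 1 + j)) ^ (s - ℓ) := by
                rw [Real.rpow_sub hu, Real.rpow_natCast, div_eq_mul_inv, mul_comm]
            _ ≤ ((2 : ℝ) ^ j) ^ (s - ℓ) :=
                Real.rpow_le_rpow_of_nonpos (by positivity) hb (by linarith)
            _ = q ^ j := by
                rw [hq, ← Real.rpow_natCast, ← Real.rpow_natCast,
                  ← Real.rpow_mul (by norm_num), ← Real.rpow_mul (by norm_num), mul_comm]

/-- The sum of `x^{-2}` over a `δ`-separated set avoiding `(-δ, δ)` is `O(δ^{-2})`. -/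
theorem sum_inv_sq_le_of_separated {α : Type*} (S : Finset α) (x : α → ℝ) {δ : ℝ} (hδ : 0 < δ)
    (h0 : ∀ v ∈ S, δ ≤ |x v|) (hsep : ∀ v ∈ S, ∀ w ∈ S, v ≠ w → δ ≤ |x v - x w|) :
    ∑ v ∈ S, ((x v) ^ 2)⁻¹ ≤ 4 * (∑' j : ℤ, ((j : ℝ) ^ 2)⁻¹) * (δ ^ 2)⁻¹ := by
  have hsum : Summable fun j : ℤ => ((j : ℝ) ^ 2)⁻¹ := by
    simpa [one_div] using (Real.summable_one_div_int_pow (p := 2)).2 (by norm_num)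
  -- Separation makes `j` injective and `|x| ≥ δ` makes it nonzero, with `|j| δ ≤ 2|x|`; squaring
  -- gives the constant `4`. The index `0` adds nothing to the series, since `0⁻¹ = 0`.
  set j : α → ℤ := fun v => ⌊x v / δ⌋ with hj
  have hlow : ∀ v, j v * δ ≤ x v := fun v => by
    rw [← le_div_iff₀ hδ]; exact Int.floor_le _
  have hup : ∀ v, x v < (j v + 1) * δ := fun v => by
    rw [← div_lt_iff₀ hδ]; exact Int.lt_floor_add_one _
  have hinj : Set.InjOn j S := by
    intro v hv w hw hvw
    by_contra hne
    have h := hsep v hv w hw hne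
    have h1 := hlow v; have h2 := hup v; have h3 := hlow w; have h4 := hup w
    rw [hvw] at h1 h2
    have : |x v - x w| < δ := by rw [abs_lt]; constructor <;> nlinarith
    linarith
  have hterm : ∀ v ∈ S, ((x v) ^ 2)⁻¹ ≤ 4 * (δ ^ 2)⁻¹ * ((j v : ℝ) ^ 2)⁻¹ := by
    intro v hv
    have hjne : j v ≠ 0 := by
      intro h
      have h1 := hlow v; have h2 := hup v
      rw [h] at h1 h2
      have : |x v| < δ := by rw [abs_lt]; constructor <;> norm_num at h1 h2 <;> linarith
      linarith [h0 v hv]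
    have hjr : (j v : ℝ) ≠ 0 := by exact_mod_cast hjne
    have hkey : |(j v : ℝ)| * δ ≤ 2 * |x v| := by
      rcases lt_or_gt_of_ne hjne with h | h
      · have h' : (j v : ℝ) ≤ -1 := by exact_mod_cast (by omega : j v ≤ -1)
        rw [abs_of_neg (by linarith)]
        have := neg_abs_le (x v); have := hup v; have := h0 v hv
        have h5 : x v < 0 := by nlinarith
        rw [abs_of_neg h5] at *
        nlinarith
      · have h' : (0 : ℝ) < j v := by exact_mod_cast h
        rw [abs_of_pos h']
        have := le_abs_self (x v); have := hlow v
        nlinarith [abs_nonneg (x v)]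
    have hsq : (j v : ℝ) ^ 2 * δ ^ 2 ≤ 4 * (x v) ^ 2 := by
      have := pow_le_pow_left₀ (by positivity) hkey 2
      rw [mul_pow, mul_pow, sq_abs, sq_abs] at this
      linarith
    have h6 : (4 * (x v) ^ 2)⁻¹ ≤ ((j v : ℝ) ^ 2 * δ ^ 2)⁻¹ := by gcongr
    rw [mul_inv, mul_inv] at h6
    linarith
  calc ∑ v ∈ S, ((x v) ^ 2)⁻¹ ≤ ∑ v ∈ S, 4 * (δ ^ 2)⁻¹ * ((j v : ℝ) ^ 2)⁻¹ :=
        Finset.sum_le_sum hterm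
    _ = 4 * (δ ^ 2)⁻¹ * ∑ v ∈ S, ((j v : ℝ) ^ 2)⁻¹ := by rw [Finset.mul_sum]
    _ = 4 * (δ ^ 2)⁻¹ * ∑ i ∈ S.image j, ((i : ℝ) ^ 2)⁻¹ := by rw [Finset.sum_image hinj]
    _ ≤ 4 * (δ ^ 2)⁻¹ * ∑' i : ℤ, ((i : ℝ) ^ 2)⁻¹ := by
        gcongr
        exact hsum.sum_le_tsum _ (fun _ _ => by positivity)
    _ = _ := by ring

/-! ### Heights and dyadic classes. -/

theorem one_le_height {d : ℕ} (m : Fin d → ℝ) : 1 ≤ height m :=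
  calc (1 : ℝ) = ∏ _i : Fin d, 1 := by simp
    _ ≤ ∏ i, max 1 |m i| := Finset.prod_le_prod (fun _ _ => zero_le_one) fun _ _ => le_max_left _ _

theorem height_le {d : ℕ} {m b : Fin d → ℝ} (h : ∀ i, max 1 |m i| ≤ b i) :
    height m ≤ ∏ i, b i :=
  Finset.prod_le_prod (fun _ _ => by positivity) fun i _ => h i

/-- The dyadic class of a coordinate. -/
noncomputable def dyad (x : ℝ) : ℕ := Nat.log 2 ⌊max 1 |x|⌋₊

theorem two_pow_dyad_le (x : ℝ) : (2 : ℝ) ^ dyad x ≤ max 1 |x| := by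
  have h1 : 1 ≤ ⌊max 1 |x|⌋₊ := Nat.le_floor (by simp)
  have h2 : 2 ^ dyad x ≤ ⌊max 1 |x|⌋₊ := Nat.pow_log_le_self 2 (by omega)
  calc (2 : ℝ) ^ dyad x = ((2 ^ dyad x : ℕ) : ℝ) := by push_cast; rfl
    _ ≤ ⌊max 1 |x|⌋₊ := by exact_mod_cast h2
    _ ≤ _ := Nat.floor_le (by positivity)

theorem lt_two_pow_dyad (x : ℝ) : max 1 |x| < 2 * 2 ^ dyad x := by
  have h2 : ⌊max 1 |x|⌋₊ < 2 ^ (dyad x + 1) := Nat.lt_pow_succ_log_self (by norm_num) _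
  have := (Nat.floor_lt (by positivity)).1 h2
  push_cast [pow_succ] at this
  linarith

/-! ### The weighted sum over the dual lattice. -/

section DualSum

variable {d ℓ : ℕ} {φ : ℝ → ℝ} {Γ : Submodule ℤ (Fin (d + 1) → ℝ)}

/-- The Diophantine condition bounds the last coordinate from below. -/
theorem le_abs_last (hmono : MonotoneOn φ (Set.Ici 1)) (hone : ∀ x, 1 ≤ x → 1 ≤ φ x)
    (hΓ : ∀ v ∈ Γ, v ≠ 0 → 1 / φ (height fun i : Fin d => v i.castSucc) <
      |height (fun i : Fin d => v i.castSucc) * v (Fin.last d)|)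
    {v : Fin (d + 1) → ℝ} (hv : v ∈ Γ) (hv0 : v ≠ 0) {H : ℝ}
    (hH : height (fun i : Fin d => v i.castSucc) ≤ H) :
    (H * φ H)⁻¹ ≤ |v (Fin.last d)| := by
  have h := hΓ v hv hv0
  set h₀ := height fun i : Fin d => v i.castSucc
  have h1 : 1 ≤ h₀ := one_le_height _
  have h2 := hone h₀ h1
  have h3 : φ h₀ ≤ φ H := hmono h1 (Set.mem_Ici.2 (h1.trans hH)) hH
  rw [abs_mul, abs_of_pos (by linarith), div_lt_iff₀ (by linarith)] at h
  rw [inv_eq_one_div, div_le_iff₀ (by nlinarith)]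
  have h4 : h₀ * φ h₀ ≤ H * φ H := mul_le_mul hH h3 (by linarith) (by linarith)
  nlinarith [abs_nonneg (v (Fin.last d))]

/-- Both the vectors of a class and their differences have coordinates at most `4·2^{a_i}`, so
`le_abs_last` supplies the separation `1/(H φ(H))` for the last coordinates. -/
theorem sum_inv_sq_class_le (hmono : MonotoneOn φ (Set.Ici 1)) (hone : ∀ x, 1 ≤ x → 1 ≤ φ x)
    (hΓ : ∀ v ∈ Γ, v ≠ 0 → 1 / φ (height fun i : Fin d => v i.castSucc) <
      |height (fun i : Fin d => v i.castSucc) * v (Fin.last d)|)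
    (S : Finset (Fin (d + 1) → ℝ)) (hS : ∀ v ∈ S, v ∈ Γ ∧ v ≠ 0) (a : Fin d → ℕ)
    (hSa : ∀ v ∈ S, ∀ i : Fin d, max 1 |v i.castSucc| ≤ 2 * 2 ^ a i) :
    ∑ v ∈ S, ((v (Fin.last d)) ^ 2)⁻¹ ≤ 4 * (∑' j : ℤ, ((j : ℝ) ^ 2)⁻¹) *
      ((∏ i, (4 * 2 ^ a i : ℝ)) * φ (∏ i, (4 * 2 ^ a i : ℝ))) ^ 2 := by
  set H : ℝ := ∏ i, (4 * 2 ^ a i : ℝ) with hHdef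
  have hH1 : 1 ≤ H := by
    calc (1 : ℝ) = ∏ _i : Fin d, 1 := by simp
      _ ≤ _ := Finset.prod_le_prod (fun _ _ => zero_le_one) fun i _ => by
        have : (1 : ℝ) ≤ 2 ^ a i := one_le_pow₀ (by norm_num)
        linarith
  have hφH := hone H hH1
  have key := sum_inv_sq_le_of_separated S (fun v => v (Fin.last d)) (δ := (H * φ H)⁻¹)
    (by positivity) ?_ ?_
  · rwa [inv_pow, inv_inv] at key
  · intro v hv
    refine le_abs_last hmono hone hΓ (hS v hv).1 (hS v hv).2 (height_le fun i => ?_)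
    have := hSa v hv i
    have : (0 : ℝ) < 2 ^ a i := by positivity
    linarith
  · intro v hv w hw hvw
    have := le_abs_last hmono hone hΓ (Γ.sub_mem (hS v hv).1 (hS w hw).1) (sub_ne_zero.2 hvw)
      (H := H) (height_le fun i => ?_)
    · simpa using this
    · have h1 := hSa v hv i
      have h2 := hSa w hw i
      have h3 := (le_max_right _ _).trans h1
      have h4 := (le_max_right _ _).trans h2
      have h5 : (1 : ℝ) ≤ 2 ^ a i := one_le_pow₀ (by norm_num)
      refine max_le (by linarith) ?_
      have := abs_sub (v i.castSucc) (w i.castSucc)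
      simp only [Pi.sub_apply]
      linarith

/-- For `H ≤ L` monotonicity gives `H φ(H) ≤ (H/L) L φ(L)`; for `H ≥ L` the growth bound costs a
further `K (H/L)^β`. The sum of two powers covers both cases without a split in the later summation.
-/
theorem sq_growth_le (hmono : MonotoneOn φ (Set.Ici 1)) (hone : ∀ x, 1 ≤ x → 1 ≤ φ x)
    {β K : ℝ} (hK : 1 ≤ K)
    (hgrow : ∀ x u : ℝ, 1 ≤ x → 1 ≤ u → φ (u * x) ≤ K * u ^ β * φ x)
    {N L K' : ℝ} (hN : 0 < N) (hL : 1 ≤ L) (hLN : L * φ L ≤ K' * N) {H : ℝ} (hH : 1 ≤ H) :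
    (H * φ H) ^ 2 ≤ N ^ 2 * ((K * K') ^ 2 * ((H / L) ^ (2 : ℝ) + (H / L) ^ (2 + 2 * β))) := by
  have hφL := hone L hL
  have hφH := hone H hH
  have hx : 0 < H / L := by positivity
  have hK' : 0 < K' := by
    by_contra! h
    nlinarith
  have hHL : H = H / L * L := by field_simp
  rcases le_total H L with h | h
  · have h1 : H * φ H ≤ N * (K * K') * (H / L) := by
      calc H * φ H ≤ H * φ L := by gcongr; exact hmono hH hL h
        _ = H / L * (L * φ L) := by field_simp
        _ ≤ H / L * (K' * N) := by gcongr
        _ ≤ H / L * (K' * N) * K := le_mul_of_one_le_right (by positivity) hK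
        _ = _ := by ring
    calc (H * φ H) ^ 2 ≤ (N * (K * K') * (H / L)) ^ 2 := by gcongr
      _ = N ^ 2 * ((K * K') ^ 2 * (H / L) ^ (2 : ℝ)) := by
        rw [Real.rpow_two]; ring
      _ ≤ _ := by
        gcongr
        exact le_add_of_nonneg_right (by positivity)
  · have h1 : H * φ H ≤ N * (K * K') * (H / L * (H / L) ^ β) := by
      have h2 : φ H ≤ K * (H / L) ^ β * φ L := by
        conv_lhs => rw [hHL]
        exact hgrow L (H / L) hL ((one_le_div (by linarith)).2 h)
      calc H * φ H ≤ H * (K * (H / L) ^ β * φ L) := by gcongr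
        _ = K * (H / L) ^ β * (H / L) * (L * φ L) := by field_simp
        _ ≤ K * (H / L) ^ β * (H / L) * (K' * N) := by gcongr
        _ = _ := by ring
    calc (H * φ H) ^ 2 ≤ (N * (K * K') * (H / L * (H / L) ^ β)) ^ 2 := by gcongr
      _ = N ^ 2 * ((K * K') ^ 2 * (H / L) ^ (2 + 2 * β)) := by
        rw [Real.rpow_add hx, Real.rpow_two, mul_comm 2 β, Real.rpow_mul hx.le, Real.rpow_two]; ring
      _ ≤ _ := by
        gcongr
        exact le_add_of_nonneg_left (by positivity)

/-- Here `H/L = ∏ 4 ρ_i 2^{a_i} / (L P)` with `P = ∏ ρ_i`. As `L P ≥ 1` and `s ≥ 1`, one may replace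
`(L P)^s` by `L P`, which cancels `P`. This is where the box must not be thin. -/
theorem class_term_le {N L s : ℝ} (hN : 0 < N) (hL : 0 < L) (hs : 1 ≤ s) {ρ : Fin d → ℝ}
    (hρ : ∀ i, 0 < ρ i) (hLρ : 1 ≤ L * ∏ i, ρ i) (a : Fin d → ℕ) :
    N * (∏ i, ρ i) * ((∏ i, (4 * 2 ^ a i : ℝ)) / L) ^ s ≤
      N / L * ∏ i, (4 ^ s * (ρ i * 2 ^ a i) ^ s) := by
  set P := ∏ i, ρ i with hP
  have hP0 : 0 < P := Finset.prod_pos fun i _ => hρ i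
  have e1 : (∏ i, (4 * 2 ^ a i : ℝ)) / L = (∏ i, (4 * (ρ i * 2 ^ a i))) / (L * P) := by
    have : ∏ i, (4 * (ρ i * 2 ^ a i)) = (∏ i, (4 * 2 ^ a i : ℝ)) * P := by
      rw [hP, ← Finset.prod_mul_distrib]
      exact Finset.prod_congr rfl fun i _ => by ring
    rw [this]
    field_simp
  have e2 : (∏ i, (4 * (ρ i * 2 ^ a i))) ^ s = ∏ i, (4 ^ s * (ρ i * 2 ^ a i) ^ s) := by
    rw [← Real.finsetProd_rpow _ _ fun i _ => by have := hρ i; positivity]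
    exact Finset.prod_congr rfl fun i _ =>
      Real.mul_rpow (by norm_num) (by have := hρ i; positivity)
  have hQ : 0 ≤ ∏ i, (4 ^ s * (ρ i * 2 ^ a i) ^ s) :=
    Finset.prod_nonneg fun i _ => by have := hρ i; positivity
  have h3 : L * P ≤ (L * P) ^ s := by
    conv_lhs => rw [← Real.rpow_one (L * P)]
    exact Real.rpow_le_rpow_of_exponent_le hLρ hs
  rw [e1, Real.div_rpow (Finset.prod_nonneg fun i _ => by have := hρ i; positivity)
    (by positivity), e2]
  calc N * P * ((∏ i, (4 ^ s * (ρ i * 2 ^ a i) ^ s)) / (L * P) ^ s)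
      ≤ N * P * ((∏ i, (4 ^ s * (ρ i * 2 ^ a i) ^ s)) / (L * P)) := by gcongr
    _ = _ := by field_simp

/-- After enlarging `A` to a cube, the sum of products is a product of `d` one-variable dyadic sums,
each bounded uniformly in `ρ i`. -/
theorem sum_class_le {s Ks : ℝ} (hKs : ∀ ρ : ℝ, 0 < ρ → ρ ≤ 1 → ∀ M : ℕ,
      ∑ a ∈ Finset.range M, decay ℓ (ρ * 2 ^ a) * (ρ * 2 ^ a) ^ s ≤ Ks)
    {ρ : Fin d → ℝ} (hρ : ∀ i, 0 < ρ i ∧ ρ i ≤ 1) (A : Finset (Fin d → ℕ)) :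
    ∑ a ∈ A, (∏ i, decay ℓ (ρ i * 2 ^ a i)) * ∏ i, (4 ^ s * (ρ i * 2 ^ a i) ^ s) ≤
      (4 ^ s * Ks) ^ d := by
  have hpos : ∀ i (n : ℕ), 0 < ρ i * 2 ^ n := fun i n => mul_pos (hρ i).1 (by positivity)
  have hnn : ∀ i (n : ℕ), 0 ≤ 4 ^ s * (decay ℓ (ρ i * 2 ^ n) * (ρ i * 2 ^ n) ^ s) := fun i n =>
    mul_nonneg (by positivity) (mul_nonneg (decay_nonneg (hpos i n).le)
      (Real.rpow_nonneg (hpos i n).le _))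
  obtain ⟨M, hM⟩ : ∃ M : ℕ, A ⊆ Fintype.piFinset fun _ => Finset.range M := by
    refine ⟨A.sup (fun a => Finset.univ.sup a) + 1, fun a ha => ?_⟩
    rw [Fintype.mem_piFinset]
    intro i
    rw [Finset.mem_range, Nat.lt_succ_iff]
    exact (Finset.le_sup (f := a) (Finset.mem_univ i)).trans
      (Finset.le_sup (f := fun a : Fin d → ℕ => Finset.univ.sup a) ha)
  calc ∑ a ∈ A, (∏ i, decay ℓ (ρ i * 2 ^ a i)) * ∏ i, (4 ^ s * (ρ i * 2 ^ a i) ^ s)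
      = ∑ a ∈ A, ∏ i, (4 ^ s * (decay ℓ (ρ i * 2 ^ a i) * (ρ i * 2 ^ a i) ^ s)) := by
        refine Finset.sum_congr rfl fun a _ => ?_
        rw [← Finset.prod_mul_distrib]
        exact Finset.prod_congr rfl fun i _ => by ring
    _ ≤ ∑ a ∈ Fintype.piFinset fun _ => Finset.range M,
          ∏ i, (4 ^ s * (decay ℓ (ρ i * 2 ^ a i) * (ρ i * 2 ^ a i) ^ s)) :=
        Finset.sum_le_sum_of_subset_of_nonneg hM fun a _ _ =>
          Finset.prod_nonneg fun i _ => hnn i _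
    _ = ∏ i, ∑ n ∈ Finset.range M, 4 ^ s * (decay ℓ (ρ i * 2 ^ n) * (ρ i * 2 ^ n) ^ s) := by
        rw [Finset.prod_univ_sum]
    _ ≤ ∏ _i : Fin d, (4 ^ s * Ks) := by
        refine Finset.prod_le_prod (fun i _ => Finset.sum_nonneg fun n _ => hnn i n)
          fun i _ => ?_
        rw [← Finset.mul_sum]
        gcongr
        exact hKs _ (hρ i).1 (hρ i).2 M
    _ = _ := by simp

/-- The sum over the non-zero vectors of a lattice with the Diophantine condition. -/
theorem exists_dual_sum_le (hmono : MonotoneOn φ (Set.Ici 1)) (hone : ∀ x, 1 ≤ x → 1 ≤ φ x)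
    {β K : ℝ} (hβ : 0 ≤ β) (hβℓ : 2 + 2 * β < ℓ) (hK : 1 ≤ K)
    (hgrow : ∀ x u : ℝ, 1 ≤ x → 1 ≤ u → φ (u * x) ≤ K * u ^ β * φ x)
    (hΓ : ∀ v ∈ Γ, v ≠ 0 → 1 / φ (height fun i : Fin d => v i.castSucc) <
      |height (fun i : Fin d => v i.castSucc) * v (Fin.last d)|) :
    ∃ C : ℝ, 0 < C ∧ ∀ N : ℝ, φ 1 ≤ N → ∀ ρ : Fin d → ℝ, (∀ i, 0 < ρ i ∧ ρ i ≤ 1) →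
      1 ≤ invL φ N * ∏ i, ρ i → ∀ S : Finset (Fin (d + 1) → ℝ), (∀ v ∈ S, v ∈ Γ ∧ v ≠ 0) →
      ∑ v ∈ S, N * (∏ i, ρ i) * ((∏ i : Fin d, decay ℓ (ρ i * max 1 |v i.castSucc|)) *
        ((N * v (Fin.last d)) ^ 2)⁻¹) ≤ C * φ (invL φ N) := by
  obtain ⟨K₁, hK₁, hs₁⟩ := exists_dyadic_sum_le (ℓ := ℓ) (s := 2) (by norm_num) (by linarith)
  obtain ⟨K₂, hK₂, hs₂⟩ := exists_dyadic_sum_le (ℓ := ℓ) (s := 2 + 2 * β) (by linarith) hβℓ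
  set K' : ℝ := 2 * (K * 2 ^ β) with hK'
  have hK'0 : 0 < K' := by positivity
  set Z : ℝ := 4 * ∑' j : ℤ, ((j : ℝ) ^ 2)⁻¹ with hZ
  have hZ0 : 0 ≤ Z := mul_nonneg (by norm_num) (tsum_nonneg fun _ => by positivity)
  set E : ℝ := (4 ^ (2 : ℝ) * K₁) ^ d + (4 ^ (2 + 2 * β) * K₂) ^ d with hE
  have hE0 : 0 < E := by positivity
  -- The last `K'` comes from `N / L ≤ K' φ(L)`; the `+ 1` makes the constant positive with only `Z
  -- ≥ 0` at hand.
  refine ⟨Z * (K * K') ^ 2 * E * K' + 1, by positivity, fun N hN ρ hρ hLρ S hS => ?_⟩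
  obtain ⟨hL, hNL, hLN⟩ := invL_bounds hmono hone hgrow hN
  set L := invL φ N with hLdef
  have hφ1 := hone 1 le_rfl
  have hN0 : 0 < N := by linarith
  have hL0 : 0 < L := by linarith
  have hφL := hone L hL
  have hP0 : 0 < ∏ i, ρ i := Finset.prod_pos fun i _ => (hρ i).1
  set D : (Fin (d + 1) → ℝ) → Fin d → ℕ := fun v i => dyad (v i.castSucc) with hD
  have hdec : ∀ (a : Fin d → ℕ), 0 ≤ ∏ i, decay ℓ (ρ i * 2 ^ a i) := fun a =>
    Finset.prod_nonneg fun i _ => decay_nonneg (mul_pos (hρ i).1 (by positivity)).le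
  have hclass : ∀ a : Fin d → ℕ,
      ∑ v ∈ S with D v = a, N * (∏ i, ρ i) *
        ((∏ i : Fin d, decay ℓ (ρ i * max 1 |v i.castSucc|)) * ((N * v (Fin.last d)) ^ 2)⁻¹) ≤
      Z * (K * K') ^ 2 * (N / L) *
        ((∏ i, decay ℓ (ρ i * 2 ^ a i)) * ∏ i, (4 ^ (2 : ℝ) * (ρ i * 2 ^ a i) ^ (2 : ℝ)) +
         (∏ i, decay ℓ (ρ i * 2 ^ a i)) *
          ∏ i, (4 ^ (2 + 2 * β) * (ρ i * 2 ^ a i) ^ (2 + 2 * β))) := by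
    intro a
    set H : ℝ := ∏ i, (4 * 2 ^ a i : ℝ) with hH
    have hH1 : 1 ≤ H := by
      calc (1 : ℝ) = ∏ _i : Fin d, 1 := by simp
        _ ≤ _ := Finset.prod_le_prod (fun _ _ => zero_le_one) fun i _ => by
          have : (1 : ℝ) ≤ 2 ^ a i := one_le_pow₀ (by norm_num)
          linarith
    have hsq := sum_inv_sq_class_le hmono hone hΓ (S.filter fun v => D v = a)
      (fun v hv => hS v (Finset.mem_filter.1 hv).1) a
      (fun v hv i => by
        have := (Finset.mem_filter.1 hv).2
        rw [← this]
        exact (lt_two_pow_dyad _).le)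
    calc _ ≤ ∑ v ∈ S with D v = a, N * (∏ i, ρ i) *
        ((∏ i, decay ℓ (ρ i * 2 ^ a i)) * (N ^ 2)⁻¹) * ((v (Fin.last d)) ^ 2)⁻¹ := by
          refine Finset.sum_le_sum fun v hv => ?_
          have hva := (Finset.mem_filter.1 hv).2
          have hprod : ∏ i : Fin d, decay ℓ (ρ i * max 1 |v i.castSucc|) ≤
              ∏ i, decay ℓ (ρ i * 2 ^ a i) := by
            refine Finset.prod_le_prod (fun i _ => decay_nonneg ?_) fun i _ => ?_
            · have := (hρ i).1
              positivity
            · have h1 := (hρ i).1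
              refine decay_anti (by positivity) ?_
              gcongr
              rw [← hva]
              exact two_pow_dyad_le _
          rw [mul_pow, mul_inv, mul_assoc (N * _), mul_assoc _ (N ^ 2)⁻¹]
          gcongr
      _ = N * (∏ i, ρ i) * ((∏ i, decay ℓ (ρ i * 2 ^ a i)) * (N ^ 2)⁻¹) *
          ∑ v ∈ S with D v = a, ((v (Fin.last d)) ^ 2)⁻¹ := by rw [Finset.mul_sum]
      _ ≤ N * (∏ i, ρ i) * ((∏ i, decay ℓ (ρ i * 2 ^ a i)) * (N ^ 2)⁻¹) *
          (Z * (H * φ H) ^ 2) := by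
          have := hdec a
          gcongr
      _ ≤ N * (∏ i, ρ i) * ((∏ i, decay ℓ (ρ i * 2 ^ a i)) * (N ^ 2)⁻¹) *
          (Z * (N ^ 2 * ((K * K') ^ 2 * ((H / L) ^ (2 : ℝ) + (H / L) ^ (2 + 2 * β))))) := by
          have := hdec a
          gcongr
          exact sq_growth_le hmono hone hK hgrow hN0 hL hLN hH1
      _ = Z * (K * K') ^ 2 * (∏ i, decay ℓ (ρ i * 2 ^ a i)) *
          (N * (∏ i, ρ i) * (H / L) ^ (2 : ℝ) + N * (∏ i, ρ i) * (H / L) ^ (2 + 2 * β)) := by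
          field_simp
      _ ≤ Z * (K * K') ^ 2 * (∏ i, decay ℓ (ρ i * 2 ^ a i)) *
          (N / L * ∏ i, (4 ^ (2 : ℝ) * (ρ i * 2 ^ a i) ^ (2 : ℝ)) +
           N / L * ∏ i, (4 ^ (2 + 2 * β) * (ρ i * 2 ^ a i) ^ (2 + 2 * β))) := by
          have := hdec a
          have h1 := class_term_le hN0 hL0 (s := 2) (by norm_num) (fun i => (hρ i).1) hLρ a
          have h2 := class_term_le hN0 hL0 (s := 2 + 2 * β) (by linarith) (fun i => (hρ i).1) hLρ a
          gcongr
      _ = _ := by ring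
  rw [← Finset.sum_fiberwise_of_maps_to (fun v hv => Finset.mem_image_of_mem D hv)]
  calc _ ≤ ∑ a ∈ S.image D, Z * (K * K') ^ 2 * (N / L) *
        ((∏ i, decay ℓ (ρ i * 2 ^ a i)) * ∏ i, (4 ^ (2 : ℝ) * (ρ i * 2 ^ a i) ^ (2 : ℝ)) +
         (∏ i, decay ℓ (ρ i * 2 ^ a i)) *
          ∏ i, (4 ^ (2 + 2 * β) * (ρ i * 2 ^ a i) ^ (2 + 2 * β))) :=
        Finset.sum_le_sum fun a _ => hclass a
    _ ≤ Z * (K * K') ^ 2 * (N / L) * E := by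
        rw [← Finset.mul_sum, Finset.sum_add_distrib]
        gcongr
        exact add_le_add (sum_class_le hs₁ hρ _) (sum_class_le hs₂ hρ _)
    _ ≤ Z * (K * K') ^ 2 * (K' * φ L) * E := by
        gcongr
        rw [div_le_iff₀ hL0]
        linarith
    _ ≤ _ := by nlinarith

end DualSum

/-! ### Poisson summation on `ℤ^ι`. -/

section Poisson

open UnitAddTorus

variable {ι : Type*}

/-- The unit cell of `ℤ^ι` with lower corner `n`. -/
def cell (n : ι → ℤ) : Set (ι → ℝ) := {x | ∀ i, x i ∈ Set.Ioc (n i : ℝ) (n i + 1)}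

theorem measurableSet_cell [Fintype ι] (n : ι → ℤ) : MeasurableSet (cell n) :=
  MeasurableSet.univ_pi' fun _ => measurableSet_Ioc

/-- Cells are open on the left and closed on the right, so the corner is `⌈x⌉ - 1` and not the
floor. Uniqueness of the corner shows that the cells tile the space. -/
theorem mem_cell_iff {n : ι → ℤ} {x : ι → ℝ} : x ∈ cell n ↔ (fun i => ⌈x i⌉ - 1) = n := by
  rw [funext_iff]
  refine forall_congr' fun i => ?_
  rw [sub_eq_iff_eq_add, Int.ceil_eq_iff]
  push_cast
  simp

/-- Unfolding: countable additivity over the tiling, each cell being translated back to the origin.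
-/
theorem hasSum_integral_cell [Fintype ι] {g : (ι → ℝ) → ℂ} (hg : Integrable g) :
    HasSum (fun n : ι → ℤ => ∫ x in cell 0, g (x + fun i => (n i : ℝ))) (∫ x, g x) := by
  have hU : (⋃ n : ι → ℤ, cell n) = (Set.univ : Set (ι → ℝ)) :=
    Set.eq_univ_of_forall fun x => Set.mem_iUnion.2 ⟨_, mem_cell_iff.2 rfl⟩
  have hdisj : Pairwise (Function.onFun Disjoint (cell : (ι → ℤ) → Set (ι → ℝ))) := by
    intro m n hmn
    refine Set.disjoint_left.2 fun x hx hx' => hmn ?_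
    rw [← mem_cell_iff.1 hx, mem_cell_iff.1 hx']
  have h := hasSum_integral_iUnion (f := g) (μ := volume) measurableSet_cell hdisj hg.integrableOn
  rw [hU, Measure.restrict_univ] at h
  rw [show (fun n : ι → ℤ => ∫ x in cell 0, g (x + fun i => (n i : ℝ))) =
    fun n => ∫ x in cell n, g x from ?_]
  · exact h
  funext n
  have hpre : cell 0 = (fun x : ι → ℝ => x + fun i => (n i : ℝ)) ⁻¹' cell n := by
    ext x
    simp only [cell, Set.mem_preimage, Set.mem_ofPred_eq, Set.mem_Ioc, Pi.add_apply, Pi.zero_apply,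
      Int.cast_zero]
    refine forall_congr' fun i => ?_
    constructor <;> rintro ⟨h1, h2⟩ <;> constructor <;> linarith
  rw [hpre]
  exact (measurePreserving_add_right volume _).setIntegral_preimage_emb
    (measurableEmbedding_addRight _) g _

theorem finite_translates [Fintype ι] {g : (ι → ℝ) → ℂ} (hc : HasCompactSupport g) (R : ℝ) :
    {n : ι → ℤ | ∃ x : ι → ℝ, ‖x‖ ≤ R ∧ g (x + fun i => (n i : ℝ)) ≠ 0}.Finite := by
  classical
  obtain ⟨r, hr⟩ := hc.isCompact.isBounded.subset_closedBall 0
  refine (Set.finite_Icc (fun _ : ι => -⌈r + R⌉) (fun _ => ⌈r + R⌉)).subset ?_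
  rintro n ⟨x, hx, hgx⟩
  have h1 := hr (subset_tsupport _ hgx)
  rw [mem_closedBall_zero_iff] at h1
  have h2 : ‖(fun i => (n i : ℝ))‖ ≤ r + R := by
    have : (fun i => (n i : ℝ)) = (x + fun i => (n i : ℝ)) - x := by abel
    rw [this]
    exact (norm_sub_le _ _).trans (add_le_add h1 hx)
  have h3 : ∀ i, |n i| ≤ ⌈r + R⌉ := fun i => by
    have h4 := (norm_le_pi_norm (fun i => (n i : ℝ)) i).trans h2
    rw [Real.norm_eq_abs] at h4
    have h5 := h4.trans (Int.le_ceil _)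
    exact_mod_cast h5
  exact ⟨fun i => (abs_le.1 (h3 i)).1, fun i => (abs_le.1 (h3 i)).2⟩

/-- The periodization of a function on `ℝ^ι`. -/
noncomputable def periodize (g : (ι → ℝ) → ℂ) (x : ι → ℝ) : ℂ :=
  ∑' n : ι → ℤ, g (x + fun i => (n i : ℝ))

/-- Compact support makes the sum locally finite. -/
theorem continuous_periodize [Fintype ι] {g : (ι → ℝ) → ℂ} (hg : Continuous g)
    (hc : HasCompactSupport g) :
    Continuous (periodize g) := by
  have heq : periodize g = fun x => ∑ᶠ n : ι → ℤ, g (x + fun i => (n i : ℝ)) := by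
    funext x
    exact tsum_eq_finsum ((finite_translates hc ‖x‖).subset fun n hn => ⟨x, le_rfl, hn⟩)
  rw [heq]
  refine continuous_finsum (fun n => hg.comp (by fun_prop)) fun x => ?_
  refine ⟨Metric.ball x 1, Metric.ball_mem_nhds x one_pos,
    (finite_translates hc (‖x‖ + 1)).subset ?_⟩
  rintro n ⟨y, hy1, hy2⟩
  refine ⟨y, ?_, hy1⟩
  rw [Metric.mem_ball, dist_eq_norm] at hy2
  have := norm_sub_norm_le y x
  linarith

theorem periodize_add_int (g : (ι → ℝ) → ℂ) (x : ι → ℝ) (m : ι → ℤ) :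
    periodize g (x + fun i => (m i : ℝ)) = periodize g x := by
  unfold periodize
  rw [← (Equiv.addLeft m).tsum_eq fun n : ι → ℤ => g (x + fun i => (n i : ℝ))]
  refine tsum_congr fun n => ?_
  congr 1
  funext i
  simp [add_assoc]

/-- Define the lift through arbitrary representatives. Periodicity makes the choice immaterial, and
continuity descends along the quotient map from `ℝ^ι` to the torus. -/
theorem exists_lift_periodize [Fintype ι] {g : (ι → ℝ) → ℂ} (hg : Continuous g)
    (hc : HasCompactSupport g) :
    ∃ F : C(UnitAddTorus ι, ℂ), ∀ x : ι → ℝ,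
      F (fun i => (x i : UnitAddCircle)) = periodize g x := by
  set F : UnitAddTorus ι → ℂ := fun t => periodize g fun i => Quotient.out (t i)
  have hF : ∀ x : ι → ℝ, F (fun i => (x i : UnitAddCircle)) = periodize g x := by
    intro x
    have h : ∀ i, ∃ n : ℤ, Quotient.out (x i : UnitAddCircle) = x i + n := by
      intro i
      have h1 : ((Quotient.out (x i : UnitAddCircle) : ℝ) : UnitAddCircle) =
          (x i : UnitAddCircle) :=
        QuotientAddGroup.out_eq' _
      rw [QuotientAddGroup.eq_iff_sub_mem, AddSubgroup.mem_zmultiples_iff] at h1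
      obtain ⟨n, hn⟩ := h1
      refine ⟨n, ?_⟩
      simp only [zsmul_eq_mul, mul_one] at hn
      linarith
    choose m hm using h
    rw [← periodize_add_int g x m]
    change periodize g _ = _
    congr 1
    funext i
    exact hm i
  have hq : IsOpenQuotientMap (Pi.map fun _ : ι => ((↑) : ℝ → UnitAddCircle)) :=
    IsOpenQuotientMap.piMap fun _ => QuotientAddGroup.isOpenQuotientMap_mk
  refine ⟨⟨F, ?_⟩, hF⟩
  rw [hq.isQuotientMap.continuous_iff]
  have : F ∘ (Pi.map fun _ : ι => ((↑) : ℝ → UnitAddCircle)) = periodize g := funext hF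
  rw [this]
  exact continuous_periodize hg hc

theorem mFourier_coe [Fintype ι] (m : ι → ℤ) (x : ι → ℝ) :
    mFourier (-m) (fun i => (x i : UnitAddCircle)) =
      Complex.exp (-2 * Real.pi * Complex.I * ((fun i => (m i : ℝ)) ⬝ᵥ x : ℝ)) := by
  simp only [mFourier, ContinuousMap.coe_mk, Pi.neg_apply, fourier_coe_apply, ← Complex.exp_sum,
    dotProduct]
  congr 1
  push_cast
  rw [Finset.mul_sum]
  refine Finset.sum_congr rfl fun i _ => ?_
  simp
  ring

/-- The Fourier transform on `ℝ^ι`, with respect to the standard bilinear form. -/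
noncomputable def fourierPi [Fintype ι] (f : (ι → ℝ) → ℂ) (v : ι → ℝ) : ℂ :=
  ∫ x, Complex.exp (-2 * Real.pi * Complex.I * (v ⬝ᵥ x : ℝ)) * f x

/-- Poisson summation on `ℤ^ι` for continuous functions of compact support. -/
theorem tsum_eq_tsum_fourierPi [Fintype ι] {g : (ι → ℝ) → ℂ} (hg : Continuous g)
    (hc : HasCompactSupport g)
    (hs : Summable fun m : ι → ℤ => fourierPi g fun i => (m i : ℝ)) :
    ∑' n : ι → ℤ, g (fun i => (n i : ℝ)) = ∑' m : ι → ℤ, fourierPi g fun i => (m i : ℝ) := by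
  obtain ⟨F, hF⟩ := exists_lift_periodize hg hc
  have hcoeff : ∀ m : ι → ℤ, mFourierCoeff F m = fourierPi g fun i => (m i : ℝ) := by
    intro m
    set e : (ι → ℝ) → ℂ := fun x =>
      Complex.exp (-2 * Real.pi * Complex.I * ((fun i => (m i : ℝ)) ⬝ᵥ x : ℝ)) with he
    have hecont : Continuous e := by
      rw [he]
      simp only [dotProduct]
      fun_prop
    set G : (ι → ℝ) → ℂ := fun x => e x * g x with hG
    have hGint : Integrable G := (hecont.mul hg).integrable_of_hasCompactSupport hc.mul_left
    have hper : ∀ (n : ι → ℤ) (x : ι → ℝ), e (x + fun i => (n i : ℝ)) = e x := by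
      intro n x
      rw [he]
      simp only
      rw [← mFourier_coe, ← mFourier_coe]
      congr 1
      funext i
      simp
    rw [mFourierCoeff_eq_integral _ _ 0]
    have hset : {x : ι → ℝ | ∀ i, x i ∈ Set.Ioc ((0 : ι → ℝ) i) ((0 : ι → ℝ) i + 1)} = cell 0 := by
      ext x; simp [cell]
    rw [hset]
    have h1 := hasSum_integral_cell hGint
    -- Unfolding the norm gives the absolute summability that permits exchanging the sum and the
    -- integral in the Fourier coefficient.
    have h2 := hasSum_integral_cell (g := fun x => ((‖G x‖ : ℝ) : ℂ)) hGint.norm.ofReal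
    have h3 := integral_tsum_of_summable_integral_norm (μ := volume.restrict (cell 0))
      (F := fun (n : ι → ℤ) x => G (x + fun i => (n i : ℝ)))
      (fun n => (hGint.comp_add_right _).integrableOn)
      (by
        have h4 := h2.summable
        simp only [integral_complex_ofReal] at h4
        exact Complex.summable_ofReal.1 h4)
    have h5 : ∫ x, G x = fourierPi g fun i => (m i : ℝ) := rfl
    rw [← h5, ← h1.tsum_eq, h3]
    refine integral_congr_ae (Eventually.of_forall fun x => ?_)
    simp only [smul_eq_mul]
    rw [hF, mFourier_coe, periodize, ← tsum_mul_left]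
    refine tsum_congr fun n => ?_
    rw [hG]
    simp only [hper]
    rfl
  have hsum : Summable (mFourierCoeff F) := by
    have : mFourierCoeff F = fun m : ι → ℤ => fourierPi g fun i => (m i : ℝ) := funext hcoeff
    rw [this]; exact hs
  -- The summable Fourier series represents the continuous lift pointwise; evaluating at the origin
  -- gives the formula.
  have h := (hasSum_mFourier_series_apply_of_summable hsum
    (fun i => ((0 : ι → ℝ) i : UnitAddCircle))).tsum_eq
  rw [hF] at h
  have h0 : periodize g 0 = ∑' n : ι → ℤ, g (fun i => (n i : ℝ)) := by
    simp [periodize]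
  rw [← h0, ← h]
  refine tsum_congr fun m => ?_
  rw [hcoeff]
  have : mFourier m (fun i => ((0 : ι → ℝ) i : UnitAddCircle)) = 1 := by
    simp [mFourier]
  rw [this, smul_eq_mul, mul_one]

end Poisson

/-! ### Passage from `ℤ^k` to a unimodular lattice. -/

/-- `A` preserves volume and `⟨w, x⟩ = ⟨A⁻ᵀ w, A x⟩`. -/
theorem fourierPi_comp_mulVec {k : ℕ} (A : Matrix (Fin k) (Fin k) ℝ) (hA : |A.det| = 1)
    {f : (Fin k → ℝ) → ℂ} (hf : Continuous f) (w : Fin k → ℝ) :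
    fourierPi (fun x => f (A *ᵥ x)) w = fourierPi f ((A⁻¹)ᵀ *ᵥ w) := by
  have hdet : A.det ≠ 0 := fun h => by simp [h] at hA
  have hmap := Real.map_matrix_volume_pi_eq_smul_volume_pi hdet
  rw [abs_inv, hA, inv_one, ENNReal.ofReal_one, one_smul] at hmap
  unfold fourierPi
  have hcont : Continuous fun y : Fin k → ℝ =>
      Complex.exp (-2 * Real.pi * Complex.I * ((A⁻¹)ᵀ *ᵥ w ⬝ᵥ y : ℝ)) * f y := by
    simp only [dotProduct]
    fun_prop
  rw [← hmap, integral_map (by fun_prop) hcont.aestronglyMeasurable, hmap]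
  refine integral_congr_ae (Eventually.of_forall fun x => ?_)
  simp only [Matrix.toLin'_apply]
  rw [Matrix.mulVec_transpose, ← Matrix.dotProduct_mulVec, Matrix.mulVec_mulVec,
    Matrix.nonsing_inv_mul A (isUnit_iff_ne_zero.2 hdet), Matrix.one_mulVec]

/-- Poisson summation for a unimodular lattice. -/
theorem exists_lattice_poisson {k : ℕ} (Λ : Submodule ℤ (Fin k → ℝ)) [DiscreteTopology Λ]
    [IsZLattice ℝ Λ] (hΛ : ZLattice.covolume Λ = 1) :
    ∃ D : (Fin k → ℤ) → (Fin k → ℝ), Function.Injective D ∧ D 0 = 0 ∧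
      (∀ m, D m ∈ dualLattice Λ) ∧
      ∀ f : (Fin k → ℝ) → ℂ, Continuous f → HasCompactSupport f →
        (Summable fun m => fourierPi f (D m)) →
        ∑' v : Λ, f v = ∑' m, fourierPi f (D m) := by
  have : Module.Free ℤ Λ := ZLattice.module_free ℝ Λ
  have : Module.Finite ℤ Λ := ZLattice.module_finite ℝ Λ
  have hrank : Module.finrank ℤ Λ = k := by rw [ZLattice.rank ℝ Λ]; simp
  let b : Module.Basis (Fin k) ℤ Λ :=
    (Module.finBasis ℤ Λ).reindex (finCongr hrank)
  set A : Matrix (Fin k) (Fin k) ℝ := (Matrix.of ((↑) ∘ b))ᵀ with hAdef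
  have hA : |A.det| = 1 := by
    rw [hAdef, Matrix.det_transpose, ← ZLattice.covolume_eq_det, hΛ]
  have hdet : IsUnit A.det := isUnit_iff_ne_zero.2 fun h => by simp [h] at hA
  have hAx : ∀ n : Fin k → ℤ, ((b.equivFun.symm n : Λ) : Fin k → ℝ) =
      A *ᵥ fun i => (n i : ℝ) := by
    intro n
    rw [Module.Basis.equivFun_symm_apply]
    funext i
    simp [hAdef, Matrix.mulVec, dotProduct, mul_comm, Finset.sum_apply]
  have hΛA : ∀ x, x ∈ Λ ↔ ∃ n : Fin k → ℤ, x = A *ᵥ (fun i => (n i : ℝ)) := by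
    intro x
    constructor
    · intro hx
      refine ⟨b.equivFun ⟨x, hx⟩, ?_⟩
      rw [← hAx]; simp
    · rintro ⟨n, rfl⟩
      rw [← hAx]; exact Subtype.prop _
  have hBt : Aᵀ * (A⁻¹)ᵀ = 1 := by
    rw [← Matrix.transpose_mul, Matrix.nonsing_inv_mul A hdet, Matrix.transpose_one]
  -- Injectivity into the dual lattice is enough later, where only upper bounds for sums of norms
  -- over nonzero frequencies are needed.
  refine ⟨fun m => (A⁻¹)ᵀ *ᵥ fun i => (m i : ℝ), ?_, ?_, ?_, ?_⟩
  · intro m n hmn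
    have h := congrArg (fun z => Aᵀ *ᵥ z) hmn
    simp only [Matrix.mulVec_mulVec, hBt, Matrix.one_mulVec] at h
    funext i
    exact_mod_cast congrFun h i
  · have : (fun i => (((0 : Fin k → ℤ) i : ℤ) : ℝ)) = 0 := by funext i; simp
    simp only [this, Matrix.mulVec_zero]
  · intro m
    exact (mem_dualLattice_iff A hdet Λ hΛA _).2 ⟨m, rfl⟩
  · intro f hf hfc hs
    have hgc : HasCompactSupport fun x => f (A *ᵥ x) := by
      let e : (Fin k → ℝ) ≃ₜ (Fin k → ℝ) :=
        { toFun := fun x => A *ᵥ x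
          invFun := fun x => A⁻¹ *ᵥ x
          left_inv := fun x => by
            simp only [Matrix.mulVec_mulVec, Matrix.nonsing_inv_mul A hdet, Matrix.one_mulVec]
          right_inv := fun x => by
            simp only [Matrix.mulVec_mulVec, Matrix.mul_nonsing_inv A hdet, Matrix.one_mulVec]
          continuous_toFun := by fun_prop
          continuous_invFun := by fun_prop }
      exact hfc.comp_homeomorph e
    have hP := tsum_eq_tsum_fourierPi (g := fun x => f (A *ᵥ x))
      (hf.comp (by fun_prop)) hgc (by
        refine hs.congr fun m => ?_
        rw [fourierPi_comp_mulVec A hA hf])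
    rw [← b.equivFun.symm.toEquiv.tsum_eq]
    calc _ = ∑' n : Fin k → ℤ, f (A *ᵥ fun i => (n i : ℝ)) :=
          tsum_congr fun n => by rw [← hAx]; rfl
      _ = _ := hP
      _ = _ := tsum_congr fun m => fourierPi_comp_mulVec A hA hf _

/-! ### Fourier transforms of products and their decay. -/

theorem fourierPi_prod {k : ℕ} (g : Fin k → ℝ → ℂ) (v : Fin k → ℝ) :
    fourierPi (fun x => ∏ i, g i (x i)) v = ∏ i, 𝓕 (g i) (v i) := by
  unfold fourierPi
  simp only [Real.fourier_real_eq_integral_exp_smul]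
  rw [← integral_fintype_prod_volume_eq_prod]
  refine integral_congr_ae (Eventually.of_forall fun x => ?_)
  simp only [smul_eq_mul]
  rw [Finset.prod_mul_distrib, ← Complex.exp_sum]
  congr 2
  simp only [dotProduct]
  push_cast
  rw [Finset.mul_sum]
  exact Finset.sum_congr rfl fun i _ => by ring

theorem fourier_comp_affine (g : ℝ → ℂ) (γ : ℝ) {ρ : ℝ} (hρ : 0 < ρ) (t : ℝ) :
    𝓕 (fun x => g ((x - γ) / ρ)) t =
      Complex.exp (-2 * Real.pi * Complex.I * (t * γ : ℝ)) * (ρ * 𝓕 g (ρ * t)) := by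
  simp only [Real.fourier_real_eq_integral_exp_smul, smul_eq_mul]
  have h := Measure.integral_comp_div (fun y : ℝ =>
    Complex.exp (↑(-2 * Real.pi * (y * ρ + γ) * t) * Complex.I) * g y) ρ
  have h' := integral_sub_right_eq_self (μ := (volume : Measure ℝ)) (fun x : ℝ =>
    Complex.exp (↑(-2 * Real.pi * (x / ρ * ρ + γ) * t) * Complex.I) * g (x / ρ)) γ
  rw [h, abs_of_pos hρ] at h'
  calc _ = ∫ x : ℝ, Complex.exp (↑(-2 * Real.pi * ((x - γ) / ρ * ρ + γ) * t) * Complex.I) *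
        g ((x - γ) / ρ) := by
        refine integral_congr_ae (Eventually.of_forall fun x => ?_)
        simp only
        rw [div_mul_cancel₀ _ hρ.ne', sub_add_cancel]
    _ = _ := h'
    _ = _ := by
        rw [Complex.real_smul, mul_left_comm]
        congr 1
        rw [← integral_const_mul]
        refine integral_congr_ae (Eventually.of_forall fun x => ?_)
        simp only
        rw [← mul_assoc, ← Complex.exp_add]
        congr 2
        push_cast
        ring

theorem hasCompactSupport_iteratedDeriv {f : ℝ → ℂ} (hf : HasCompactSupport f) (m : ℕ) :
    HasCompactSupport (iteratedDeriv m f) := by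
  induction m with
  | zero => simpa using hf
  | succ m ih => rw [iteratedDeriv_succ]; exact ih.deriv

/-- Decay of the Fourier transform of a `C^n` function of compact support. -/
theorem exists_pow_mul_norm_hat_le {g : ℝ → ℝ} {n : ℕ} (hg : ContDiff ℝ n g)
    (hc : HasCompactSupport g) : ∃ C : ℝ, 0 ≤ C ∧ ∀ t, |t| ^ n * ‖hat g t‖ ≤ C := by
  set f : ℝ → ℂ := fun x => (g x : ℂ) with hf
  have hfd : ContDiff ℝ ((n : ℕ∞) : WithTop ℕ∞) f := Complex.ofRealCLM.contDiff.comp hg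
  have hfc : HasCompactSupport f := hc.comp_left (g := fun x : ℝ => (x : ℂ)) (by simp)
  have hint : ∀ m : ℕ, (m : ℕ∞) ≤ (n : ℕ∞) → Integrable (iteratedDeriv m f) := fun m hm =>
    (hfd.continuous_iteratedDeriv m (by exact_mod_cast hm)).integrable_of_hasCompactSupport
      (hasCompactSupport_iteratedDeriv hfc m)
  have h := Real.fourier_iteratedDeriv (n := n) hfd hint le_rfl
  refine ⟨∫ x, ‖iteratedDeriv n f x‖, integral_nonneg fun _ => norm_nonneg _, fun t => ?_⟩
  have h1 : ‖𝓕 (iteratedDeriv n f) t‖ ≤ ∫ x, ‖iteratedDeriv n f x‖ :=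
    VectorFourier.norm_fourierIntegral_le_integral_norm _ _ _ _ _
  rw [h] at h1
  simp only [norm_smul, norm_pow, norm_mul, Complex.norm_I, Complex.norm_real, Real.norm_eq_abs,
    Complex.norm_ofNat, mul_one, abs_of_pos Real.pi_pos] at h1
  refine le_trans ?_ h1
  change |t| ^ n * ‖𝓕 f t‖ ≤ _
  gcongr
  have : 1 ≤ 2 * Real.pi := by linarith [Real.pi_gt_three]
  nlinarith [abs_nonneg t]

/-- Uniform decay estimates for a `C^ℓ` function of compact support, `ℓ ≥ 2`. -/
theorem exists_hat_decay {g : ℝ → ℝ} {ℓ : ℕ} (hℓ : 2 ≤ ℓ) (hg : ContDiff ℝ ℓ g)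
    (hc : HasCompactSupport g) : ∃ C : ℝ, 0 < C ∧
      (∀ t, ‖hat g t‖ ≤ C * (t ^ 2)⁻¹ ∨ t = 0) ∧
      ∀ ρ v : ℝ, 0 < ρ → ρ ≤ 1 → ‖hat g (ρ * v)‖ ≤ C * decay ℓ (ρ * max 1 |v|) := by
  obtain ⟨C₀, h0, hC₀⟩ := exists_pow_mul_norm_hat_le (n := 0) (hg.of_le (by simp)) hc
  obtain ⟨C₂, h2, hC₂⟩ := exists_pow_mul_norm_hat_le (n := 2) (hg.of_le (by exact_mod_cast hℓ)) hc
  obtain ⟨C₁, h1, hC₁⟩ := exists_pow_mul_norm_hat_le (n := ℓ) hg hc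
  refine ⟨C₀ + C₂ + C₁ + 1, by positivity, fun t => ?_, fun ρ v hρ hρ1 => ?_⟩
  -- At `t = 0` the right side is `0` by the convention for inverses, so this point has to be
  -- excepted.
  · by_cases ht : t = 0
    · exact Or.inr ht
    · left
      rw [← div_eq_mul_inv, le_div_iff₀ (by positivity)]
      have := hC₂ t
      rw [sq_abs] at this
      linarith
  · have hb : ‖hat g (ρ * v)‖ ≤ C₀ := by simpa using hC₀ (ρ * v)
    rcases lt_or_ge |v| 1 with hv | hv
    · rw [max_eq_left hv.le, mul_one]
      have : decay ℓ ρ = 1 := min_eq_left ((one_le_inv₀ (by positivity)).2 (pow_le_one₀ hρ.le hρ1))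
      rw [this]
      linarith
    · rw [max_eq_right hv, decay, mul_min_of_nonneg _ _ (by positivity)]
      refine le_min (by linarith) ?_
      have h3 := hC₁ (ρ * v)
      rw [abs_mul, abs_of_pos hρ] at h3
      rw [← div_eq_mul_inv, le_div_iff₀ (by positivity)]
      linarith

/-! ### Box functions and the discrepancy as a lattice sum. -/

/-- A product of rescaled one-variable functions, as in the definition of the discrepancy. -/
noncomputable def boxFun {k : ℕ} (ψ : Fin k → ℝ → ℝ) (γ ρ : Fin k → ℝ) (x : Fin k → ℝ) : ℝ :=
  ∏ i, ψ i ((x i - γ i) / ρ i)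

theorem hasCompactSupport_boxFun {k : ℕ} {ψ : Fin k → ℝ → ℝ} (hψ : ∀ i, HasCompactSupport (ψ i))
    (γ : Fin k → ℝ) {ρ : Fin k → ℝ} (hρ : ∀ i, 0 < ρ i) : HasCompactSupport (boxFun ψ γ ρ) := by
  refine HasCompactSupport.intro (K := Set.univ.pi fun i => (fun y => ρ i * y + γ i) ''
    tsupport (ψ i)) (isCompact_univ_pi fun i => (hψ i).isCompact.image (by fun_prop)) fun x hx => ?_
  simp only [Set.mem_pi, Set.mem_univ, true_implies, not_forall] at hx
  obtain ⟨i, hi⟩ := hx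
  refine Finset.prod_eq_zero (Finset.mem_univ i) (image_eq_zero_of_notMem_tsupport fun h => hi ?_)
  refine ⟨_, h, ?_⟩
  have := (hρ i).ne'
  field_simp
  ring

theorem continuous_boxFun {k : ℕ} {ψ : Fin k → ℝ → ℝ} (hψ : ∀ i, Continuous (ψ i))
    (γ ρ : Fin k → ℝ) : Continuous (boxFun ψ γ ρ) :=
  continuous_finsetProd _ fun i _ => (hψ i).comp (by fun_prop)

theorem fourierPi_boxFun {k : ℕ} (ψ : Fin k → ℝ → ℝ) (γ : Fin k → ℝ) {ρ : Fin k → ℝ}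
    (hρ : ∀ i, 0 < ρ i) (v : Fin k → ℝ) :
    fourierPi (fun x => (boxFun ψ γ ρ x : ℂ)) v =
      ∏ i, (Complex.exp (-2 * Real.pi * Complex.I * (v i * γ i : ℝ)) *
        (ρ i * hat (ψ i) (ρ i * v i))) := by
  have h : (fun x => (boxFun ψ γ ρ x : ℂ)) =
      fun x => ∏ i, (fun y : ℝ => (ψ i ((y - γ i) / ρ i) : ℂ)) (x i) := by
    funext x
    simp [boxFun]
  rw [h, fourierPi_prod fun i y => (ψ i ((y - γ i) / ρ i) : ℂ)]
  exact Finset.prod_congr rfl fun i _ =>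
    fourier_comp_affine (fun y => (ψ i y : ℂ)) (γ i) (hρ i) (v i)

theorem norm_fourierPi_boxFun {k : ℕ} (ψ : Fin k → ℝ → ℝ) (γ : Fin k → ℝ) {ρ : Fin k → ℝ}
    (hρ : ∀ i, 0 < ρ i) (v : Fin k → ℝ) :
    ‖fourierPi (fun x => (boxFun ψ γ ρ x : ℂ)) v‖ = ∏ i, (ρ i * ‖hat (ψ i) (ρ i * v i)‖) := by
  rw [fourierPi_boxFun ψ γ hρ, norm_prod]
  refine Finset.prod_congr rfl fun i _ => ?_
  have : ‖Complex.exp (-2 * Real.pi * Complex.I * (v i * γ i : ℝ))‖ = 1 := by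
    rw [Complex.norm_exp]
    simp
  rw [norm_mul, this, one_mul, norm_mul, Complex.norm_real, Real.norm_of_nonneg (hρ i).le]

theorem hat_zero_eq (g : ℝ → ℝ) : hat g 0 = ((hat g 0).re : ℂ) := by
  have h : hat g 0 = ((∫ x, g x : ℝ) : ℂ) := by
    unfold hat
    rw [Real.fourier_real_eq_integral_exp_smul, ← integral_complex_ofReal]
    simp
  rw [h, Complex.ofReal_re]

theorem fourierPi_boxFun_zero {k : ℕ} (ψ : Fin k → ℝ → ℝ) (γ : Fin k → ℝ) {ρ : Fin k → ℝ}
    (hρ : ∀ i, 0 < ρ i) :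
    fourierPi (fun x => (boxFun ψ γ ρ x : ℂ)) 0 = ((weightConst ψ * ∏ i, ρ i : ℝ) : ℂ) := by
  rw [fourierPi_boxFun ψ γ hρ, weightConst, ← Finset.prod_mul_distrib]
  push_cast
  refine Finset.prod_congr rfl fun i _ => ?_
  simp only [Pi.zero_apply, mul_zero, zero_mul, Complex.ofReal_zero, Complex.exp_zero, one_mul]
  rw [mul_comm, ← hat_zero_eq]

/-- Treating the last variable as one more side, with centre `0` and length `N`, puts all `d + 1`
variables on the same footing. -/
theorem boxDiscrepancy_eq {d : ℕ} (ψ : Fin (d + 1) → ℝ → ℝ) (Λ : Submodule ℤ (Fin (d + 1) → ℝ))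
    (γ ρ : Fin d → ℝ) (N : ℝ) :
    boxDiscrepancy ψ Λ γ ρ N =
      ∑' v : Λ, boxFun ψ (Fin.snoc γ 0 : Fin (d + 1) → ℝ) (Fin.snoc ρ N : Fin (d + 1) → ℝ) v -
      weightConst ψ * ∏ i, (Fin.snoc ρ N : Fin (d + 1) → ℝ) i := by
  unfold boxDiscrepancy boxFun
  simp only [Fin.prod_univ_castSucc, Fin.snoc_castSucc, Fin.snoc_last, sub_zero]
  congr 1
  exact tsum_congr fun v => mul_comm _ _

theorem snoc_pos {d : ℕ} {ρ : Fin d → ℝ} (hρ : ∀ i, 0 < ρ i) {N : ℝ} (hN : 0 < N)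
    (i : Fin (d + 1)) : 0 < (Fin.snoc ρ N : Fin (d + 1) → ℝ) i := by
  refine Fin.lastCases ?_ (fun i => ?_) i
  · rwa [Fin.snoc_last]
  · rw [Fin.snoc_castSucc]; exact hρ i

/-- A lattice sum is its zero frequency up to the total mass of the remaining ones. -/
theorem norm_tsum_sub_le {α : Type*} {F : α → ℂ} (a : α) {B : ℝ}
    (hB : ∀ T : Finset α, a ∉ T → ∑ m ∈ T, ‖F m‖ ≤ B) :
    Summable F ∧ ‖∑' m, F m - F a‖ ≤ B := by
  classical
  set G : α → ℂ := fun m => if m = a then 0 else F m with hG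
  have hsum : ∀ T : Finset α, ∑ m ∈ T, ‖G m‖ ≤ B := by
    intro T
    have h1 : ∑ m ∈ T, ‖G m‖ = ∑ m ∈ T.erase a, ‖F m‖ := by
      rw [← Finset.filter_ne' T a, Finset.sum_filter]
      refine Finset.sum_congr rfl fun m _ => ?_
      by_cases h : m = a <;> simp [hG, h]
    rw [h1]
    exact hB _ (Finset.notMem_erase a T)
  have hGn : Summable fun m => ‖G m‖ := summable_of_sum_le (fun _ => norm_nonneg _) hsum
  have hFs : Summable F := by
    have h2 : F = fun m => G m + if m = a then F a else 0 := by
      funext m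
      by_cases h : m = a <;> simp [hG, h]
    rw [h2]
    exact hGn.of_norm.add (hasSum_ite_eq a (F a)).summable
  refine ⟨hFs, ?_⟩
  rw [hFs.tsum_eq_add_tsum_ite a, add_sub_cancel_left]
  exact (norm_tsum_le_tsum_norm hGn).trans (hGn.tsum_le_of_sum_le hsum)

theorem summable_of_hasCompactSupport {d : ℕ} {Λ : Submodule ℤ (Fin (d + 1) → ℝ)}
    [DiscreteTopology Λ] {f : (Fin (d + 1) → ℝ) → ℝ} (hf : HasCompactSupport f) :
    Summable fun v : Λ => f v := by
  have hcl : IsClosed (Λ : Set (Fin (d + 1) → ℝ)) := by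
    have : DiscreteTopology Λ.toAddSubgroup := ‹DiscreteTopology Λ›
    exact AddSubgroup.isClosed_of_discrete (H := Λ.toAddSubgroup)
  have hfin : (tsupport f ∩ (Λ : Set (Fin (d + 1) → ℝ))).Finite := by
    have : DiscreteTopology ((Λ : Set (Fin (d + 1) → ℝ)) : Type) := ‹DiscreteTopology Λ›
    exact Metric.finite_isBounded_inter_isClosed DiscreteTopology.isDiscrete
      hf.isCompact.isBounded hcl
  refine summable_of_hasFiniteSupport ((hfin.preimage Subtype.val_injective.injOn).subset ?_)
  intro v hv
  exact ⟨subset_tsupport _ hv, v.2⟩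

/-! ### The discrepancy of thick and of thin boxes. -/

section Discrepancy

variable {d ℓ : ℕ} {φ : ℝ → ℝ} {Λ : Submodule ℤ (Fin (d + 1) → ℝ)} [DiscreteTopology Λ]
  [IsZLattice ℝ Λ]

/-- The discrepancy estimate for boxes that are not too thin. -/
theorem exists_boxDiscrepancy_le_of_one_le (hΛ : ZLattice.covolume Λ = 1)
    (hmono : MonotoneOn φ (Set.Ici 1)) (hone : ∀ x, 1 ≤ x → 1 ≤ φ x)
    {β K : ℝ} (hβ : 0 ≤ β) (hβℓ : 2 + 2 * β < ℓ) (hK : 1 ≤ K)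
    (hgrow : ∀ x u : ℝ, 1 ≤ x → 1 ≤ u → φ (u * x) ≤ K * u ^ β * φ x)
    (hdual : ∀ v ∈ dualLattice Λ, v ≠ 0 → 1 / φ (height fun i : Fin d => v i.castSucc) <
      |height (fun i : Fin d => v i.castSucc) * v (Fin.last d)|)
    {ψ : Fin (d + 1) → ℝ → ℝ} (hψ : ∀ i, ContDiff ℝ ℓ (ψ i))
    (hψc : ∀ i, HasCompactSupport (ψ i)) :
    ∃ C : ℝ, 0 < C ∧ ∀ N : ℝ, φ 1 ≤ N → ∀ γ ρ : Fin d → ℝ, (∀ i, 0 < ρ i ∧ ρ i ≤ 1) →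
      1 ≤ invL φ N * ∏ i, ρ i → |boxDiscrepancy ψ Λ γ ρ N| ≤ C * φ (invL φ N) := by
  have hℓ2 : 2 ≤ ℓ := by
    have : (2 : ℝ) < ℓ := by linarith
    exact_mod_cast this.le
  obtain ⟨C₁, hC₁, hsum⟩ := exists_dual_sum_le hmono hone hβ hβℓ hK hgrow hdual
  choose c hc hc2 hcℓ using fun i => exists_hat_decay hℓ2 (hψ i) (hψc i)
  obtain ⟨D, hDinj, hD0, hDdual, hPoisson⟩ := exists_lattice_poisson Λ hΛ
  set Q : ℝ := ∏ i, c i with hQ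
  have hQ0 : 0 < Q := Finset.prod_pos fun i _ => hc i
  refine ⟨Q * C₁, by positivity, fun N hN γ ρ hρ hLρ => ?_⟩
  have hN0 : 0 < N := by linarith [hone 1 le_rfl]
  set γ' : Fin (d + 1) → ℝ := Fin.snoc γ 0 with hγ'
  set ρ' : Fin (d + 1) → ℝ := Fin.snoc ρ N with hρ'
  have hρ'0 : ∀ i, 0 < ρ' i := snoc_pos (fun i => (hρ i).1) hN0
  set f : (Fin (d + 1) → ℝ) → ℂ := fun x => (boxFun ψ γ' ρ' x : ℂ) with hf
  have hterm : ∀ v ∈ dualLattice Λ, v ≠ 0 → ‖fourierPi f v‖ ≤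
      Q * (N * (∏ i, ρ i) * ((∏ i : Fin d, decay ℓ (ρ i * max 1 |v i.castSucc|)) *
        ((N * v (Fin.last d)) ^ 2)⁻¹)) := by
    intro v hv hv0
    -- The Diophantine condition excludes a vanishing last coordinate, so the quadratic decay in
    -- that variable is available.
    have hvl : v (Fin.last d) ≠ 0 := by
      intro h
      have h1 := hdual v hv hv0
      rw [h, mul_zero, abs_zero] at h1
      have := hone _ (one_le_height fun i : Fin d => v i.castSucc)
      have : (0 : ℝ) < 1 / φ (height fun i : Fin d => v i.castSucc) := by positivity
      linarith
    rw [hf, norm_fourierPi_boxFun ψ γ' hρ'0, Fin.prod_univ_castSucc, hQ, Fin.prod_univ_castSucc]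
    simp only [hρ', Fin.snoc_castSucc, Fin.snoc_last]
    have h1 : ∏ i : Fin d, (ρ i * ‖hat (ψ i.castSucc) (ρ i * v i.castSucc)‖) ≤
        ∏ i : Fin d, (ρ i * (c i.castSucc * decay ℓ (ρ i * max 1 |v i.castSucc|))) := by
      refine Finset.prod_le_prod (fun i _ => mul_nonneg (hρ i).1.le (norm_nonneg _)) fun i _ => ?_
      exact mul_le_mul_of_nonneg_left (hcℓ _ _ _ (hρ i).1 (hρ i).2) (hρ i).1.le
    have h2 : ‖hat (ψ (Fin.last d)) (N * v (Fin.last d))‖ ≤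
        c (Fin.last d) * ((N * v (Fin.last d)) ^ 2)⁻¹ :=
      (hc2 (Fin.last d) _).resolve_right (mul_ne_zero hN0.ne' hvl)
    have h3 : 0 ≤ ∏ i : Fin d, (ρ i * (c i.castSucc * decay ℓ (ρ i * max 1 |v i.castSucc|))) :=
      Finset.prod_nonneg fun i _ => by
        have := (hρ i).1
        have := hc i.castSucc
        have := decay_nonneg (ℓ := ℓ) (t := ρ i * max 1 |v i.castSucc|) (by positivity)
        positivity
    calc _ ≤ (∏ i : Fin d, (ρ i * (c i.castSucc * decay ℓ (ρ i * max 1 |v i.castSucc|)))) *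
        (N * (c (Fin.last d) * ((N * v (Fin.last d)) ^ 2)⁻¹)) := by gcongr
      _ = _ := by
        rw [Finset.prod_mul_distrib, Finset.prod_mul_distrib]
        ring
  have hfin : ∀ T : Finset (Fin (d + 1) → ℤ), 0 ∉ T →
      ∑ m ∈ T, ‖fourierPi f (D m)‖ ≤ Q * C₁ * φ (invL φ N) := by
    intro T hT
    have hne : ∀ m ∈ T, D m ≠ 0 := fun m hm h => by
      rw [← hD0] at h
      exact hT (hDinj h ▸ hm)
    have h1 := hsum N hN ρ hρ hLρ (T.image D) (fun v hv => by
      obtain ⟨m, hm, rfl⟩ := Finset.mem_image.1 hv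
      exact ⟨hDdual m, hne m hm⟩)
    rw [Finset.sum_image hDinj.injOn] at h1
    calc _ ≤ _ := Finset.sum_le_sum fun m hm => hterm (D m) (hDdual m) (hne m hm)
      _ = _ := by rw [← Finset.mul_sum]
      _ ≤ Q * (C₁ * φ (invL φ N)) := mul_le_mul_of_nonneg_left h1 hQ0.le
      _ = _ := by ring
  obtain ⟨hs, hle⟩ := norm_tsum_sub_le 0 hfin
  have hfc : Continuous f :=
    Complex.continuous_ofReal.comp (continuous_boxFun (fun i => (hψ i).continuous) _ _)
  have hfs : HasCompactSupport f :=
    (hasCompactSupport_boxFun hψc γ' hρ'0).comp_left (g := fun x : ℝ => (x : ℂ)) (by simp)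
  -- The term at frequency `0` is the main term `weightConst ψ * ∏ ρ'`, so the bound on the other
  -- frequencies is the bound on the discrepancy.
  rw [← hPoisson f hfc hfs hs, hD0, fourierPi_boxFun_zero ψ γ' hρ'0, ← Complex.ofReal_tsum,
    ← Complex.ofReal_sub, Complex.norm_real, Real.norm_eq_abs] at hle
  rw [boxDiscrepancy_eq]
  exact hle

/-- Thin boxes can be enlarged to boxes of volume exactly `1 / L`. -/
theorem exists_enlarged {L : ℝ} (hL : 1 ≤ L) {ρ : Fin d → ℝ} (hρ : ∀ i, 0 < ρ i ∧ ρ i ≤ 1)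
    (hLρ : L * ∏ i, ρ i < 1) :
    ∃ ρ' : Fin d → ℝ, (∀ i, 0 < ρ' i ∧ ρ' i ≤ 1) ∧ (∀ i, ρ i ≤ ρ' i) ∧ L * ∏ i, ρ' i = 1 := by
  set P := ∏ i, ρ i with hP
  have hP0 : 0 < P := Finset.prod_pos fun i _ => (hρ i).1
  have hlogL : 0 ≤ Real.log L := Real.log_nonneg hL
  have hlog : Real.log L + Real.log P < 0 := by
    rw [← Real.log_mul (by linarith) hP0.ne']
    exact Real.log_neg (by positivity) hLρ
  -- Chosen so that `P ^ t = 1 / L`. Since `1 / L > P` one has `t ≤ 1`, so raising each side to the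
  -- power `t` enlarges it while keeping it at most `1`.
  set t := Real.log L / -Real.log P with ht
  have hden : 0 < -Real.log P := by linarith
  have ht0 : 0 ≤ t := div_nonneg hlogL hden.le
  have ht1 : t ≤ 1 := (div_le_one hden).2 (by linarith)
  refine ⟨fun i => ρ i ^ t, fun i => ⟨Real.rpow_pos_of_pos (hρ i).1 _,
    Real.rpow_le_one (hρ i).1.le (hρ i).2 ht0⟩, fun i => ?_, ?_⟩
  · conv_lhs => rw [← Real.rpow_one (ρ i)]
    exact Real.rpow_le_rpow_of_exponent_ge (hρ i).1 (hρ i).2 ht1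
  · rw [Real.finsetProd_rpow _ _ fun i _ => (hρ i).1.le, ← hP]
    have h : P ^ t = L⁻¹ := by
      rw [Real.rpow_def_of_pos hP0, ← Real.exp_log (show 0 < L by linarith), ← Real.exp_neg]
      congr 1
      have hP' : Real.log P ≠ 0 := (neg_pos.1 hden).ne
      rw [ht]
      field_simp
    rw [h, mul_inv_cancel₀ (by linarith)]

/-- A weight need not grow when its box is enlarged, but the plateau function `χ` equals `1` on the
support `[-2, 2]`, and larger sides only bring the argument closer to `0`. -/
theorem boxFun_le_of_le {k : ℕ} {ω : Fin k → ℝ → ℝ} (hnn : ∀ i x, 0 ≤ ω i x)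
    (hsupp : ∀ i, tsupport (ω i) ⊆ Set.Icc (-2) 2) {B : ℝ} (hB : ∀ i x, ω i x ≤ B) (hB0 : 0 ≤ B)
    {χ : ℝ → ℝ} (hχ0 : ∀ x, 0 ≤ χ x) (hχ : ∀ x, |x| ≤ 2 → χ x = 1) (γ : Fin k → ℝ)
    {ρ ρ' : Fin k → ℝ} (hρ : ∀ i, 0 < ρ i) (hρρ' : ∀ i, ρ i ≤ ρ' i) (x : Fin k → ℝ) :
    boxFun ω γ ρ x ≤ B ^ k * boxFun (fun _ => χ) γ ρ' x := by
  have hrhs : B ^ k * boxFun (fun _ => χ) γ ρ' x = ∏ i, (B * χ ((x i - γ i) / ρ' i)) := by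
    rw [Finset.prod_mul_distrib, Finset.prod_const, Finset.card_univ, Fintype.card_fin, boxFun]
  rw [hrhs]
  refine Finset.prod_le_prod (fun i _ => hnn _ _) fun i _ => ?_
  by_cases h : (x i - γ i) / ρ i ∈ tsupport (ω i)
  · have h1 := abs_le.2 (hsupp i h)
    have h2 : |(x i - γ i) / ρ' i| ≤ 2 := by
      refine le_trans ?_ h1
      rw [abs_div, abs_div, abs_of_pos (hρ i), abs_of_pos ((hρ i).trans_le (hρρ' i))]
      have := hρ i
      have := hρρ' i
      gcongr
    rw [hχ _ h2, mul_one]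
    exact hB _ _
  · rw [image_eq_zero_of_notMem_tsupport h]
    exact mul_nonneg hB0 (hχ0 _)

/-- The thick case is applied twice, to `ω` itself and to the bump `χ` on the enlarged box. For a
thin box no cancellation is needed: the lattice sum lies between `0` and a constant times the sum
for `χ`, and both main terms are `≪ N / L ≪ φ(L)`. -/
theorem exists_boxDiscrepancy_le (hΛ : ZLattice.covolume Λ = 1)
    (hmono : MonotoneOn φ (Set.Ici 1)) (hone : ∀ x, 1 ≤ x → 1 ≤ φ x)
    {β K : ℝ} (hβ : 0 ≤ β) (hβℓ : 2 + 2 * β < ℓ) (hK : 1 ≤ K)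
    (hgrow : ∀ x u : ℝ, 1 ≤ x → 1 ≤ u → φ (u * x) ≤ K * u ^ β * φ x)
    (hdual : ∀ v ∈ dualLattice Λ, v ≠ 0 → 1 / φ (height fun i : Fin d => v i.castSucc) <
      |height (fun i : Fin d => v i.castSucc) * v (Fin.last d)|)
    {ω : Fin (d + 1) → ℝ → ℝ} (hω : ∀ i, ContDiff ℝ ℓ (ω i)) (hnn : ∀ i x, 0 ≤ ω i x)
    (hsupp : ∀ i, tsupport (ω i) ⊆ Set.Icc (-2) 2) :
    ∃ C : ℝ, 0 < C ∧ ∀ N : ℝ, φ 1 ≤ N → ∀ γ ρ : Fin d → ℝ, (∀ i, 0 < ρ i ∧ ρ i ≤ 1) →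
      |boxDiscrepancy ω Λ γ ρ N| ≤ C * φ (invL φ N) := by
  have hωc : ∀ i, HasCompactSupport (ω i) := fun i =>
    isCompact_Icc.of_isClosed_subset (isClosed_tsupport _) (hsupp i)
  let χ : ContDiffBump (0 : ℝ) := ⟨2, 3, by norm_num, by norm_num⟩
  have hχ1 : ∀ x : ℝ, |x| ≤ 2 → χ x = 1 := fun x hx =>
    χ.one_of_mem_closedBall (by simpa [Real.norm_eq_abs] using hx)
  have hχc : ∀ _i : Fin (d + 1), HasCompactSupport χ := fun _ => χ.hasCompactSupport
  obtain ⟨C₁, hC₁, h₁⟩ :=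
    exists_boxDiscrepancy_le_of_one_le hΛ hmono hone hβ hβℓ hK hgrow hdual hω hωc
  obtain ⟨C₂, hC₂, h₂⟩ :=
    exists_boxDiscrepancy_le_of_one_le hΛ hmono hone hβ hβℓ hK hgrow hdual
      (ψ := fun _ => χ) (fun _ => χ.contDiff) hχc
  choose b hb using fun i => (hω i).continuous.bounded_above_of_compact_support (hωc i)
  set B : ℝ := ∑ i, |b i| with hBdef
  have hB0 : 0 ≤ B := Finset.sum_nonneg fun _ _ => abs_nonneg _
  have hB : ∀ i x, ω i x ≤ B := fun i x =>
    (le_abs_self _).trans (((hb i x).trans (le_abs_self _)).trans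
      (Finset.single_le_sum (f := fun i => |b i|) (fun _ _ => abs_nonneg _) (Finset.mem_univ i)))
  set K' : ℝ := 2 * (K * 2 ^ β) with hK'
  have hK'0 : 0 < K' := by positivity
  set w := |weightConst ω|
  set w' := |weightConst (k := d + 1) fun _ => (χ : ℝ → ℝ)|
  refine ⟨C₁ + (B ^ (d + 1) * (C₂ + w' * K') + w * K'), by positivity, fun N hN γ ρ hρ => ?_⟩
  obtain ⟨hL, hNL, -⟩ := invL_bounds hmono hone hgrow hN
  set L := invL φ N with hLdef
  have hφL := hone L hL
  have hN0 : 0 < N := by linarith [hone 1 le_rfl]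
  have hrest : 0 ≤ B ^ (d + 1) * (C₂ + w' * K') + w * K' := by positivity
  rcases le_or_gt 1 (L * ∏ i, ρ i) with hcase | hcase
  · refine (h₁ N hN γ ρ hρ hcase).trans ?_
    gcongr
    linarith
  · obtain ⟨ρ', hρ', hρρ', hLρ'⟩ := exists_enlarged hL hρ hcase
    have hvol : (∏ i, ρ' i) * N ≤ K' * φ L := by
      have hP : 0 ≤ ∏ i, ρ' i := Finset.prod_nonneg fun i _ => (hρ' i).1.le
      calc (∏ i, ρ' i) * N ≤ (∏ i, ρ' i) * (K' * (L * φ L)) := by gcongr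
        _ = K' * φ L * (L * ∏ i, ρ' i) := by ring
        _ = _ := by rw [hLρ', mul_one]
    have hvol' : (∏ i, ρ i) * N ≤ K' * φ L := by
      refine le_trans ?_ hvol
      gcongr with i
      · exact fun i _ => (hρ i).1.le
      · exact hρρ' i
    have hX := h₂ N hN γ ρ' hρ' hLρ'.ge
    rw [boxDiscrepancy_eq] at hX ⊢
    set γ₁ : Fin (d + 1) → ℝ := Fin.snoc γ 0
    set ρ₁ : Fin (d + 1) → ℝ := Fin.snoc ρ N with hρ₁
    set ρ₂ : Fin (d + 1) → ℝ := Fin.snoc ρ' N with hρ₂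
    have hρ₁0 : ∀ i, 0 < ρ₁ i := snoc_pos (fun i => (hρ i).1) hN0
    have hρ₂0 : ∀ i, 0 < ρ₂ i := snoc_pos (fun i => (hρ' i).1) hN0
    have hρ₁₂ : ∀ i, ρ₁ i ≤ ρ₂ i := fun i => by
      refine Fin.lastCases ?_ (fun i => ?_) i
      · rw [hρ₁, hρ₂, Fin.snoc_last, Fin.snoc_last]
      · rw [hρ₁, hρ₂, Fin.snoc_castSucc, Fin.snoc_castSucc]; exact hρρ' i
    have hprod₁ : ∏ i, ρ₁ i = (∏ i, ρ i) * N := by simp [hρ₁, Fin.prod_univ_castSucc]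
    have hprod₂ : ∏ i, ρ₂ i = (∏ i, ρ' i) * N := by simp [hρ₂, Fin.prod_univ_castSucc]
    rw [hprod₂] at hX
    rw [hprod₁]
    have hle : ∑' v : Λ, boxFun ω γ₁ ρ₁ v ≤
        B ^ (d + 1) * ∑' v : Λ, boxFun (fun _ => χ) γ₁ ρ₂ v := by
      rw [← tsum_mul_left]
      refine Summable.tsum_le_tsum (fun v => ?_)
        (summable_of_hasCompactSupport (hasCompactSupport_boxFun hωc γ₁ hρ₁0))
        ((summable_of_hasCompactSupport (hasCompactSupport_boxFun hχc γ₁ hρ₂0)).mul_left _)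
      exact boxFun_le_of_le hnn hsupp hB hB0 (fun _ => χ.nonneg) hχ1 γ₁ hρ₁0 hρ₁₂ v
    have hnn' : 0 ≤ ∑' v : Λ, boxFun ω γ₁ ρ₁ v :=
      tsum_nonneg fun v => Finset.prod_nonneg fun i _ => hnn _ _
    have hmain : |weightConst ω * ((∏ i, ρ i) * N)| ≤ w * (K' * φ L) := by
      rw [abs_mul, abs_of_nonneg (a := (∏ i, ρ i) * N)
        (mul_nonneg (Finset.prod_nonneg fun i _ => (hρ i).1.le) hN0.le)]
      gcongr
    have hmain' : weightConst (k := d + 1) (fun _ => (χ : ℝ → ℝ)) * ((∏ i, ρ' i) * N) ≤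
        w' * (K' * φ L) := by
      refine (le_abs_self _).trans ?_
      rw [abs_mul, abs_of_nonneg (a := (∏ i, ρ' i) * N)
        (mul_nonneg (Finset.prod_nonneg fun i _ => (hρ' i).1.le) hN0.le)]
      gcongr
    have hS : ∑' v : Λ, boxFun (fun _ => χ) γ₁ ρ₂ v ≤ C₂ * φ L + w' * (K' * φ L) := by
      have := (le_abs_self _).trans hX
      linarith
    have hS' : ∑' v : Λ, boxFun ω γ₁ ρ₁ v ≤ B ^ (d + 1) * (C₂ * φ L + w' * (K' * φ L)) :=
      hle.trans (by gcongr)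
    calc _ ≤ |∑' v : Λ, boxFun ω γ₁ ρ₁ v| + |weightConst ω * ((∏ i, ρ i) * N)| := abs_sub _ _
      _ ≤ B ^ (d + 1) * (C₂ * φ L + w' * (K' * φ L)) + w * (K' * φ L) := by
        rw [abs_of_nonneg hnn']
        exact add_le_add hS' hmain
      _ = (B ^ (d + 1) * (C₂ + w' * K') + w * K') * φ L := by ring
      _ ≤ _ := mul_le_mul_of_nonneg_right (by linarith) (by linarith)

end Discrepancy

end SmoothDiscrepancy

/-! ### The theorem. -/

theorem theorem1p10 (d : ℕ) (hd : 1 ≤ d) (ℓ : ℕ) (ω : Fin (d + 1) → ℝ → ℝ)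
    (hω : SmoothDiscrepancy.IsWeight (d + 1) ℓ ω)
    (Λ : Submodule ℤ (Fin (d + 1) → ℝ)) [DiscreteTopology Λ] [IsZLattice ℝ Λ]
    (hΛ : ZLattice.covolume Λ = 1)
    (φ : ℝ → ℝ) (hφ_mono : MonotoneOn φ (Set.Ici 1)) (hφ_one : ∀ x, 1 ≤ x → 1 ≤ φ x)
    (hdual : ∀ v ∈ SmoothDiscrepancy.dualLattice Λ, v ≠ 0 →
      1 / φ (SmoothDiscrepancy.height fun i : Fin d => v i.castSucc) <
        |SmoothDiscrepancy.height (fun i : Fin d => v i.castSucc) * v (Fin.last d)|)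
    (ξ : ℝ)
    (hξ : Filter.limsup (fun x : ℝ => ((φ (2 * x) / φ x : ℝ) : EReal)) Filter.atTop = (ξ : EReal))
    (hℓ : 2 + 2 * (Real.log ξ / Real.log 2) < (ℓ : ℝ)) :
    ∃ C : ℝ, 0 < C ∧ ∀ N : ℝ, φ 1 ≤ N →
      SmoothDiscrepancy.latticeDiscrepancy ω Λ N ≤
        ENNReal.ofReal (C * φ (SmoothDiscrepancy.invL φ N)) := by
  obtain ⟨β, K, hβ, hβℓ, hK, hgrow⟩ := SmoothDiscrepancy.exists_growth hφ_mono hφ_one hξ hℓ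
  obtain ⟨C, hC, h⟩ := SmoothDiscrepancy.exists_boxDiscrepancy_le hΛ hφ_mono hφ_one hβ hβℓ hK hgrow
    hdual hω.contDiff hω.nonneg hω.supp
  refine ⟨C, hC, fun N hN => iSup_le fun γ => iSup_le fun ρ => iSup_le fun hρ => ?_⟩
  -- The estimate is proved for sides up to `1` because enlarging a thin box may carry its sides
  -- beyond `1/2`.
  exact ENNReal.ofReal_le_ofReal
    (h N hN γ ρ fun i => ⟨(hρ i).1, (hρ i).2.le.trans (by norm_num)⟩)
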